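/- Let $n,k\ge 1$ be integers and $r=2k$. Let $\|\cdot\|$ be the uniform norm on $\mathbb R$, and let $T_{n-1}^\perp$ be the set of continuous $2\pi$-periodic functions $f:\mathbb R\to\mathbb R$ with $\int_{-\pi}^{\pi} f\tau\,dx=0$ for every real trigonometric polynomial $\tau$ of degree $\le n-1$. Put $$\widehat\Delta_t^{2k}(f,x)=\sum_{i=-k}^{k}(-1)^i\binom{2k}{k+i}f(x+it),\qquad \phi_h(t)=\begin{cases}\frac1h\bigl(1-\frac{|t|}{h}\bigr),&|t|\le h,\\ 0,&|t|>h,\end{cases}$$ $$\omega_{2k}^*(f,h)=\Bigl\|\int_{\mathbb R}\widehat\Delta_t^{2k}(f,\cdot)\,\phi_h(t)\,dt\Bigr\|,\qquad \gamma_r^*=\binom{r}{\lfloor r/2\rfloor}^{-1},\qquad \mu_{2k}^2=\frac{8}{\pi^2}\sum_{\substack{1\le i\le k\\ i\ \mathrm{odd}}}\frac{1}{i^2}\binom{2k}{k+i}\binom{2k}{k}^{-1}.$$ Then $\mu_r^2<1$ and $$\frac{\gamma_r^*}{1-\mu_r^2}\;\le\;\sup_{0\ne f\in T_{n-1}^\perp}\frac{\|f\|}{\omega_r^*(f,\pi/n)}\;\le\;\frac4\pi\,\frac{\gamma_r^*}{1-\mu_r^2},$$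 where $\omega_r^*(f,\pi/n)>0$ for every nonzero $f\in T_{n-1}^\perp$. Moreover $$\frac{\gamma_r^*}{1-\mu_r^2}\asymp\sqrt r\,\gamma_r^*\asymp\frac{r}{2^r},$$ where $\asymp$ means two-sided bounds with positive absolute constants, valid for all even $r\ge 2$. -/

import Mathlib

open scoped ENNReal

noncomputable section

namespace JacksonStechkin

/-- The uniform norm of `f : ℝ → ℝ`, as an extended non-negative real. -/
def uniformNorm (f : ℝ → ℝ) : ℝ≥0∞ := ⨆ x : ℝ, ‖f x‖ₑ

/-- The space of real trigonometric polynomials of degree at most `m`. -/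
def trigPoly (m : ℕ) : Submodule ℝ (ℝ → ℝ) :=
  Submodule.span ℝ
    {g | ∃ j : ℕ, j ≤ m ∧
      (g = (fun x => Real.cos ((j : ℝ) * x)) ∨ g = (fun x => Real.sin ((j : ℝ) * x)))}

/-- The continuous `2π`-periodic functions that are orthogonal on `[-π, π]` to all
trigonometric polynomials of degree at most `m`. -/
def trigPerp (m : ℕ) : Set (ℝ → ℝ) :=
  {f | Continuous f ∧ Function.Periodic f (2 * Real.pi) ∧
    ∀ τ ∈ trigPoly m, ∫ x in (-Real.pi)..Real.pi, f x * τ x = 0}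

/-- The central difference of order `2 * k` of `f` at `x` with step `t`. -/
def centralDiff (k : ℕ) (t : ℝ) (f : ℝ → ℝ) (x : ℝ) : ℝ :=
  ∑ i ∈ Finset.Icc (-(k : ℤ)) (k : ℤ),
    (-1 : ℝ) ^ i * ((2 * k).choose ((k : ℤ) + i).toNat : ℝ) * f (x + (i : ℝ) * t)

/-- The hat function supported on `[-h, h]` with integral `1` (for `h > 0`). -/
def hat (h t : ℝ) : ℝ := if |t| ≤ h then 1 / h * (1 - |t| / h) else 0

/-- The averaged modulus of smoothness of order `2 * k` of `f` with step `h`. -/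
def omegaStar (k : ℕ) (f : ℝ → ℝ) (h : ℝ) : ℝ≥0∞ :=
  uniformNorm (fun x => ∫ t : ℝ, centralDiff k t f x * hat h t)

/-- `γ_r^*`, the reciprocal of the central binomial coefficient of order `r`. -/
def gammaStar (r : ℕ) : ℝ := 1 / (r.choose (r / 2) : ℝ)

/-- The ratios `a_i` of binomial coefficients of order `2 * k`. -/
def binomRatio (k i : ℕ) : ℝ := ((2 * k).choose (k + i) : ℝ) / ((2 * k).choose k : ℝ)

/-- The number `μ_r ^ 2` for `r = 2 * k`. -/
def muSq (k : ℕ) : ℝ :=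
  8 / Real.pi ^ 2 * ∑ i ∈ (Finset.Icc 1 k).filter (fun i => Odd i), binomRatio k i / (i : ℝ) ^ 2

/-- The supremum of `‖f‖ / ω_r^*(f, π / n)`, `r = 2 * k`, over the continuous `2π`-periodic `f`
orthogonal to the trigonometric polynomials of degree at most `n - 1`. In `ℝ≥0∞` one has
`0 / 0 = 0`, so `f = 0` contributes nothing, and `a / 0 = ∞` for `a ≠ 0`, so a nonzero `f` with
vanishing modulus would make the supremum infinite. -/
def supRatio (k n : ℕ) : ℝ≥0∞ :=
  ⨆ f ∈ trigPerp (n - 1), uniformNorm f / omegaStar k f (Real.pi / n)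

end JacksonStechkin

end

open Real

namespace JacksonStechkin

open Filter Topology

/-! With h = π/n, pairing the terms ±i of the central difference and averaging against the hat gives
C(2k,k)(f - Uf), where U = `avgOp` is a Fourier multiplier. The ratio is therefore controlled by how
well 1 - U can be inverted on functions with no frequency below n.

Lower bound: cos(nx) is an eigenfunction of U with eigenvalue μ² (`avgOp_cos`), so it already gives
γ*/(1 - μ²).

Upper bound: write f = Σ_{j<M} U^j(f - Uf) + U^M f and estimate ‖U^m‖ on high frequencies.
Integrating cosines against the hat factors U as G∘I, where G = `diffOp` is a finite difference
operator and I has multiplier ν^{-2}. Then U^m = G^m∘I^m. The norm of G is at most n²μ²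
(`abs_diffOp_le`). The operator I^m is convolution with a single kernel of L¹ norm at most
(4/π)n^{-2m} (`exists_kernel`), so the factor 4/π enters once rather than m times. Hence ‖U^m‖ ≤
(4/π)μ^{2m}, and the geometric series gives (4/π)/(1 - μ²).

The kernel is cos(nt)P(t)/(2π), with P a cosine series with convex coefficients. Convexity makes P ≥
0, so the L¹ norm is ∫|cos nt|P, which the Fourier series of |cos nt| evaluates.

Asymptotics: since Σ 1/i² over odd i is π²/8, 1 - μ² is a series of (1 - a_i)/i², with a_i =
`binomRatio k i`. Each term is comparable to 1/(k + i²), so the sum has order 1/√k. -/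

/-! ### Periodic functions, harmonics and Fourier multipliers. -/

/-- Continuous `2π`-periodic functions. -/
def IsCircleFun (f : ℝ → ℝ) : Prop := Continuous f ∧ Function.Periodic f (2 * π)

/-- The harmonics of frequency `ν`. -/
def IsHarmonic (ν : ℕ) (e : ℝ → ℝ) : Prop :=
  (e = fun x => cos (ν * x)) ∨ e = fun x => sin (ν * x)

/-- The `L²` pairing over a period. -/
noncomputable def pair (f e : ℝ → ℝ) : ℝ := ∫ x in (-π)..π, f x * e x

lemma IsHarmonic.isCircleFun {ν : ℕ} {e : ℝ → ℝ} (he : IsHarmonic ν e) : IsCircleFun e := by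
  rcases he with rfl | rfl
  · refine ⟨by fun_prop, fun x => ?_⟩
    have : (ν : ℝ) * (x + 2 * π) = ν * x + ν * (2 * π) := by ring
    simp only [this, cos_add_nat_mul_two_pi]
  · refine ⟨by fun_prop, fun x => ?_⟩
    have : (ν : ℝ) * (x + 2 * π) = ν * x + ν * (2 * π) := by ring
    simp only [this, sin_add_nat_mul_two_pi]

lemma IsHarmonic.add_add_sub {ν : ℕ} {e : ℝ → ℝ} (he : IsHarmonic ν e) (x a : ℝ) :
    e (x - a) + e (x + a) = 2 * cos (ν * a) * e x := by
  rcases he with rfl | rfl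
  · simp only [mul_sub, mul_add, cos_sub, cos_add]; ring
  · simp only [mul_sub, mul_add, sin_sub, sin_add]; ring

lemma IsCircleFun.comp_add {f : ℝ → ℝ} (hf : IsCircleFun f) (a : ℝ) :
    IsCircleFun (fun x => f (x + a)) := by
  refine ⟨hf.1.comp (by fun_prop), fun x => ?_⟩
  have := hf.2 (x + a)
  simpa [add_right_comm] using this

lemma IsCircleFun.integral_comp_add {f : ℝ → ℝ} (hf : IsCircleFun f) (a : ℝ) :
    ∫ x in (-π)..π, f (x + a) = ∫ x in (-π)..π, f x := by
  rw [intervalIntegral.integral_comp_add_right]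
  have := hf.2.intervalIntegral_add_eq (-π + a) (-π)
  convert this using 2 <;> ring

lemma IsCircleFun.mul {f g : ℝ → ℝ} (hf : IsCircleFun f) (hg : IsCircleFun g) :
    IsCircleFun (fun x => f x * g x) :=
  ⟨hf.1.mul hg.1, hf.2.mul hg.2⟩

lemma IsCircleFun.exists_bound {f : ℝ → ℝ} (hf : IsCircleFun f) : ∃ B, ∀ x, |f x| ≤ B := by
  obtain ⟨B, hB⟩ := isCompact_Icc.exists_bound_of_continuousOn
    (s := Set.Icc (0 : ℝ) (0 + 2 * π)) hf.1.continuousOn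
  refine ⟨B, fun x => ?_⟩
  obtain ⟨y, hy, hxy⟩ := hf.2.exists_mem_Ico (by positivity) x 0
  rw [hxy]
  exact hB y ⟨hy.1, hy.2.le⟩

/-- Translation invariance moves the shifts onto `e`, where the addition formula applies. Besides
making symmetric shifts multipliers, this yields the orthogonality relations for |cos nt| and cos nt
without computing integrals. -/
lemma pair_shift {f e : ℝ → ℝ} {ν : ℕ} (hf : IsCircleFun f) (he : IsHarmonic ν e) (a : ℝ) :
    pair (fun x => f (x + a) + f (x - a)) e = 2 * cos (ν * a) * pair f e := by
  have hec := he.isCircleFun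
  have key : ∀ b : ℝ, ∫ x in (-π)..π, f (x + b) * e x = ∫ x in (-π)..π, f x * e (x - b) := by
    intro b
    have h1 : IsCircleFun (fun x => f x * e (x - b)) := by
      simpa [sub_eq_add_neg] using hf.mul (hec.comp_add (-b))
    rw [← h1.integral_comp_add b]
    simp
  have hi : ∀ b : ℝ, IntervalIntegrable (fun x => f (x + b) * e x) MeasureTheory.volume (-π) π :=
    fun b => (((hf.comp_add b).mul hec).1).intervalIntegrable _ _
  have hi' : ∀ b : ℝ, IntervalIntegrable (fun x => f x * e (x + b)) MeasureTheory.volume (-π) π :=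
    fun b => ((hf.mul (hec.comp_add b)).1).intervalIntegrable _ _
  unfold pair
  rw [← intervalIntegral.integral_const_mul]
  calc ∫ x in (-π)..π, (f (x + a) + f (x - a)) * e x
      = ∫ x in (-π)..π, (f (x + a) * e x + f (x + -a) * e x) := by
        congr 1; ext x; rw [sub_eq_add_neg]; ring
    _ = ∫ x in (-π)..π, (f x * e (x + -a) + f x * e (x + a)) := by
        rw [intervalIntegral.integral_add (hi a) (hi (-a)), key, key,
          intervalIntegral.integral_add (hi' _) (hi' _)]
        simp [sub_eq_add_neg]
    _ = _ := by
        congr 1; ext x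
        have := he.add_add_sub x a
        rw [sub_eq_add_neg] at this
        linear_combination f x * this

/-- A continuous periodic function is determined by its Fourier coefficients. -/
lemma eq_zero_of_pair {f : ℝ → ℝ} (hf : IsCircleFun f)
    (h : ∀ ν e, IsHarmonic ν e → pair f e = 0) : f = 0 := by
  have : Fact (0 < 2 * π) := ⟨by positivity⟩
  have hper : Function.Periodic (fun x => (f x : ℂ)) (2 * π) := fun x => by
    simp only [hf.2 x]
  have hcont : Continuous (fun x => (f x : ℂ)) := Complex.continuous_ofReal.comp hf.1
  let F : C(AddCircle (2 * π), ℂ) := ⟨hper.lift, continuous_coinduced_dom.mpr hcont⟩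
  have hF : ∀ x : ℝ, F (x : AddCircle (2 * π)) = f x := fun x => hper.lift_coe x
  -- The parameter `s` = ∓1 covers the exponentials e^{∓ijx}, hence Fourier coefficients of both
  -- signs.
  have h0 : ∀ j : ℕ, ∀ s : ℝ,
      ∫ x in (-π)..π, ((cos (j * x) : ℂ) + s * sin (j * x) * Complex.I) * (f x : ℂ) = 0 := by
    intro j s
    have hc := h j _ (Or.inl rfl)
    have hs := h j _ (Or.inr rfl)
    have e1 : ∀ x : ℝ, ((cos (j * x) : ℂ) + s * sin (j * x) * Complex.I) * (f x : ℂ)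
        = ((f x * cos (j * x) : ℝ) : ℂ) + (s * Complex.I) * ((f x * sin (j * x) : ℝ) : ℂ) := by
      intro x; push_cast; ring
    have c1 : Continuous fun x => ((f x * cos (j * x) : ℝ) : ℂ) :=
      Complex.continuous_ofReal.comp (hf.1.mul (by fun_prop))
    have c2 : Continuous fun x => ((f x * sin (j * x) : ℝ) : ℂ) :=
      Complex.continuous_ofReal.comp (hf.1.mul (by fun_prop))
    have c3 : Continuous fun x => (s * Complex.I : ℂ) * ((f x * sin (j * x) : ℝ) : ℂ) :=
      continuous_const.mul c2
    simp only [e1]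
    rw [intervalIntegral.integral_add (c1.intervalIntegrable _ _)
      (c3.intervalIntegrable _ _), intervalIntegral.integral_const_mul,
      intervalIntegral.integral_ofReal, intervalIntegral.integral_ofReal]
    unfold pair at hc hs
    rw [hc, hs]; simp
  have hcoef : ∀ ν : ℤ, fourierCoeff F ν = 0 := by
    intro ν
    rw [fourierCoeff_eq_intervalIntegral F ν (-π)]
    have hb : -π + 2 * π = π := by ring
    rw [hb]
    have : ∫ x in (-π)..π, (fourier (-ν)) (x : AddCircle (2 * π)) • F x = 0 := by
      obtain ⟨j, rfl | rfl⟩ := ν.eq_nat_or_neg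
      · rw [← h0 j (-1)]
        congr 1; ext x
        rw [hF, fourier_coe_apply, smul_eq_mul]
        congr 1
        have : 2 * (π : ℂ) * Complex.I * ((-(j : ℤ) : ℤ) : ℂ) * x / ((2 * π : ℝ) : ℂ)
            = ((-(j * x) : ℝ) : ℂ) * Complex.I := by
          have : (π : ℂ) ≠ 0 := by exact_mod_cast pi_ne_zero
          push_cast; field_simp
        rw [this, Complex.exp_mul_I, ← Complex.ofReal_cos, ← Complex.ofReal_sin]
        simp
      · rw [← h0 j 1]
        congr 1; ext x
        rw [hF, fourier_coe_apply, smul_eq_mul]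
        congr 1
        have : 2 * (π : ℂ) * Complex.I * ((-(-(j : ℤ)) : ℤ) : ℂ) * x / ((2 * π : ℝ) : ℂ)
            = (((j * x) : ℝ) : ℂ) * Complex.I := by
          have : (π : ℂ) ≠ 0 := by exact_mod_cast pi_ne_zero
          push_cast; field_simp
        rw [this, Complex.exp_mul_I, ← Complex.ofReal_cos, ← Complex.ofReal_sin]
        simp
    rw [this, smul_zero]
  -- Vanishing coefficients are summable, so the Fourier series converges to `F`; but it is the zero
  -- series.
  have hsum := hasSum_fourier_series_of_summable (f := F) (by
    rw [funext hcoef]; exact summable_zero)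
  simp only [hcoef, zero_smul] at hsum
  have hF0 : F = 0 := hsum.unique hasSum_zero
  ext x
  have := hF x
  rw [hF0] at this
  simpa using this.symm

/-- `T` acts on the harmonics of frequency `ν` as multiplication by `m ν`. -/
structure HasMultiplier (T : (ℝ → ℝ) → ℝ → ℝ) (m : ℕ → ℝ) : Prop where
  isCircleFun : ∀ f, IsCircleFun f → IsCircleFun (T f)
  pair_eq : ∀ f, IsCircleFun f → ∀ ν e, IsHarmonic ν e → pair (T f) e = m ν * pair f e

lemma IsCircleFun.add {f g : ℝ → ℝ} (hf : IsCircleFun f) (hg : IsCircleFun g) :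
    IsCircleFun (fun x => f x + g x) :=
  ⟨hf.1.add hg.1, hf.2.add hg.2⟩

lemma IsCircleFun.const_mul {f : ℝ → ℝ} (hf : IsCircleFun f) (c : ℝ) :
    IsCircleFun (fun x => c * f x) :=
  ⟨continuous_const.mul hf.1, fun x => by simp only [hf.2 x]⟩

lemma IsCircleFun.sub {f g : ℝ → ℝ} (hf : IsCircleFun f) (hg : IsCircleFun g) :
    IsCircleFun (fun x => f x - g x) :=
  ⟨hf.1.sub hg.1, hf.2.sub hg.2⟩

lemma pair_add {f g e : ℝ → ℝ} (hf : IsCircleFun f) (hg : IsCircleFun g) (he : IsCircleFun e) :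
    pair (fun x => f x + g x) e = pair f e + pair g e := by
  unfold pair
  rw [← intervalIntegral.integral_add ((hf.mul he).1.intervalIntegrable _ _)
    ((hg.mul he).1.intervalIntegrable _ _)]
  congr 1; ext x; ring

lemma pair_const_mul (f e : ℝ → ℝ) (c : ℝ) : pair (fun x => c * f x) e = c * pair f e := by
  unfold pair
  rw [← intervalIntegral.integral_const_mul]
  congr 1; ext x; ring

lemma pair_sub {f g e : ℝ → ℝ} (hf : IsCircleFun f) (hg : IsCircleFun g) (he : IsCircleFun e) :
    pair (fun x => f x - g x) e = pair f e - pair g e := by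
  unfold pair
  rw [← intervalIntegral.integral_sub ((hf.mul he).1.intervalIntegrable _ _)
    ((hg.mul he).1.intervalIntegrable _ _)]
  congr 1; ext x; ring

namespace HasMultiplier

variable {S T : (ℝ → ℝ) → ℝ → ℝ} {m m' : ℕ → ℝ}

lemma id : HasMultiplier (fun f => f) (fun _ => 1) :=
  ⟨fun _ h => h, fun _ _ _ _ _ => (one_mul _).symm⟩

lemma shift (a : ℝ) :
    HasMultiplier (fun f x => f (x + a) + f (x - a)) (fun ν => 2 * cos (ν * a)) :=
  ⟨fun f hf => by
      simpa [sub_eq_add_neg] using (hf.comp_add a).add (hf.comp_add (-a)),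
    fun _ hf _ _ he => pair_shift hf he a⟩

lemma const_mul (hT : HasMultiplier T m) (c : ℝ) :
    HasMultiplier (fun f x => c * T f x) (fun ν => c * m ν) :=
  ⟨fun f hf => (hT.1 f hf).const_mul c, fun f hf ν e he => by
    rw [pair_const_mul, hT.2 f hf ν e he, mul_assoc]⟩

lemma add (hS : HasMultiplier S m) (hT : HasMultiplier T m') :
    HasMultiplier (fun f x => S f x + T f x) (fun ν => m ν + m' ν) :=
  ⟨fun f hf => (hS.1 f hf).add (hT.1 f hf), fun f hf ν e he => by
    rw [pair_add (hS.1 f hf) (hT.1 f hf) he.isCircleFun, hS.2 f hf ν e he, hT.2 f hf ν e he]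
    ring⟩

lemma sub (hS : HasMultiplier S m) (hT : HasMultiplier T m') :
    HasMultiplier (fun f x => S f x - T f x) (fun ν => m ν - m' ν) :=
  ⟨fun f hf => (hS.1 f hf).sub (hT.1 f hf), fun f hf ν e he => by
    rw [pair_sub (hS.1 f hf) (hT.1 f hf) he.isCircleFun, hS.2 f hf ν e he, hT.2 f hf ν e he]
    ring⟩

lemma sum {ι : Type*} (s : Finset ι) {T : ι → (ℝ → ℝ) → ℝ → ℝ} {m : ι → ℕ → ℝ}
    (h : ∀ i ∈ s, HasMultiplier (T i) (m i)) :
    HasMultiplier (fun f x => ∑ i ∈ s, T i f x) (fun ν => ∑ i ∈ s, m i ν) := by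
  classical
  induction s using Finset.induction_on with
  | empty =>
    refine ⟨fun f _ => ⟨by simpa using continuous_const, fun x => by simp⟩, fun f _ ν e _ => ?_⟩
    simp [pair]
  | insert a s ha ih =>
    simp only [Finset.sum_insert ha]
    exact (h a (Finset.mem_insert_self _ _)).add
      (ih fun i hi => h i (Finset.mem_insert_of_mem hi))

lemma comp (hS : HasMultiplier S m) (hT : HasMultiplier T m') :
    HasMultiplier (fun f => S (T f)) (fun ν => m ν * m' ν) :=
  ⟨fun f hf => hS.1 _ (hT.1 f hf), fun f hf ν e he => by
    rw [hS.2 _ (hT.1 f hf) ν e he, hT.2 f hf ν e he, mul_assoc]⟩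

lemma iterate (hT : HasMultiplier T m) (j : ℕ) :
    HasMultiplier (fun f => T^[j] f) (fun ν => m ν ^ j) := by
  induction j with
  | zero => simpa using HasMultiplier.id
  | succ j ih =>
    simp only [Function.iterate_succ_apply', pow_succ']
    exact hT.comp ih

/-- Averages of symmetric translates are multipliers. -/
lemma integral_shift {κ : ℝ → ℝ} (hκ : Continuous κ) (a c : ℝ) :
    HasMultiplier (fun f x => ∫ t in (0 : ℝ)..a, κ t * (f (x + c * t) + f (x - c * t)))
      (fun ν => ∫ t in (0 : ℝ)..a, κ t * (2 * cos (ν * (c * t)))) := by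
  refine ⟨fun f hf => ⟨?_, fun x => ?_⟩, fun f hf ν e he => ?_⟩
  · have := hf.1
    apply intervalIntegral.continuous_parametric_intervalIntegral_of_continuous'
    unfold Function.uncurry
    fun_prop
  · have h1 : ∀ b, f (x + 2 * π + b) = f (x + b) := fun b => by
      rw [add_right_comm]; exact hf.2 _
    have h2 : ∀ b, f (x + 2 * π - b) = f (x - b) := fun b => by
      rw [sub_eq_add_neg, h1, ← sub_eq_add_neg]
    simp only [h1, h2]
  · have hfc := hf.1
    have hec := he.isCircleFun.1
    unfold pair
    simp only [← intervalIntegral.integral_mul_const]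
    have hsw : ∫ x in (-π)..π, ∫ t in (0 : ℝ)..a, κ t * (f (x + c * t) + f (x - c * t)) * e x
        = ∫ t in (0 : ℝ)..a, ∫ x in (-π)..π, κ t * (f (x + c * t) + f (x - c * t)) * e x := by
      apply MeasureTheory.intervalIntegral_intervalIntegral_swap
      have hc : Continuous (Function.uncurry fun x t : ℝ =>
          κ t * (f (x + c * t) + f (x - c * t)) * e x) := by
        unfold Function.uncurry
        fun_prop
      exact (hc.continuousOn.integrableOn_compact
        (isCompact_uIcc.prod isCompact_uIcc)).mono_set
        (Set.prod_mono Set.uIoc_subset_uIcc Set.uIoc_subset_uIcc)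
    rw [hsw]
    congr 1; ext t
    have := pair_shift hf he (c * t)
    unfold pair at this
    rw [mul_assoc, ← this, ← intervalIntegral.integral_const_mul]
    congr 1; ext x; ring

end HasMultiplier

/-- Circle functions whose Fourier coefficients of frequency `< n` vanish. -/
def IsHighFreq (n : ℕ) (f : ℝ → ℝ) : Prop :=
  IsCircleFun f ∧ ∀ ν < n, ∀ e, IsHarmonic ν e → pair f e = 0

/-- Reduces operator identities to identities between numbers: the frequencies below n are killed by
`f`, the others by equality of the multipliers. -/
lemma HasMultiplier.apply_eq {S T : (ℝ → ℝ) → ℝ → ℝ} {m m' : ℕ → ℝ} {n : ℕ}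
    (hS : HasMultiplier S m) (hT : HasMultiplier T m') (h : ∀ ν, n ≤ ν → m ν = m' ν)
    {f : ℝ → ℝ} (hf : IsHighFreq n f) : S f = T f := by
  have h0 := eq_zero_of_pair ((hS.1 f hf.1).sub (hT.1 f hf.1)) (fun ν e he => by
    rw [pair_sub (hS.1 f hf.1) (hT.1 f hf.1) he.isCircleFun, hS.2 f hf.1 ν e he,
      hT.2 f hf.1 ν e he]
    rcases lt_or_ge ν n with hν | hν
    · rw [hf.2 ν hν e he]; ring
    · rw [h ν hν]; ring)
  ext x
  have := congrFun h0 x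
  simp only [Pi.zero_apply] at this
  linarith

lemma HasMultiplier.isHighFreq {T : (ℝ → ℝ) → ℝ → ℝ} {m : ℕ → ℝ} (hT : HasMultiplier T m)
    {n : ℕ} {f : ℝ → ℝ} (hf : IsHighFreq n f) : IsHighFreq n (T f) :=
  ⟨hT.1 f hf.1, fun ν hν e he => by rw [hT.2 f hf.1 ν e he, hf.2 ν hν e he, mul_zero]⟩

lemma isHighFreq_of_mem_trigPerp {n : ℕ} (hn : 1 ≤ n) {f : ℝ → ℝ} (hf : f ∈ trigPerp (n - 1)) :
    IsHighFreq n f := by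
  refine ⟨⟨hf.1, hf.2.1⟩, fun ν hν e he => hf.2.2 e (Submodule.subset_span ⟨ν, by omega, he⟩)⟩

/-! ### Nonnegative cosine series and integrals against them. -/

lemma alternating_sum_nonneg {b : ℕ → ℝ} (hb : Antitone b) (h0 : ∀ i, 0 ≤ b i) (N : ℕ) :
    0 ≤ ∑ i ∈ Finset.range N, (-1) ^ i * b i := by
  have h : ∀ N, 0 ≤ ∑ i ∈ Finset.range (2 * N), (-1) ^ i * b i := by
    intro N
    induction N with
    | zero => simp
    | succ N ih =>
      rw [show 2 * (N + 1) = 2 * N + 1 + 1 by ring, Finset.sum_range_succ, Finset.sum_range_succ]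
      have := hb (Nat.le_succ (2 * N))
      simp only [Nat.succ_eq_add_one] at this
      rw [pow_succ, pow_mul]
      norm_num
      linarith
  obtain ⟨M, rfl | rfl⟩ := Nat.even_or_odd' N
  · exact h M
  · rw [Finset.sum_range_succ, pow_mul]
    have := h M
    have := h0 (2 * M)
    norm_num
    linarith

lemma hasSum_sub_succ {f : ℕ → ℝ} (hf : Antitone f) (h : Tendsto f atTop (𝓝 0)) :
    HasSum (fun j => f j - f (j + 1)) (f 0) := by
  rw [hasSum_iff_tendsto_nat_of_nonneg (fun j => sub_nonneg.2 (hf (Nat.le_succ j)))]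
  simp only [Finset.sum_range_sub']
  simpa using h.const_sub (f 0)

/-- The even cosine series with coefficients `p`. -/
noncomputable def cosSeries (p : ℕ → ℝ) (x : ℝ) : ℝ := 2 * ∑' s : ℕ, p s * cos (s * x) - p 0

section cosSeries

variable {p : ℕ → ℝ}

lemma summable_mul_cos (h0 : ∀ s, 0 ≤ p s) (hs : Summable p) (g : ℕ → ℝ) :
    Summable (fun s => p s * cos (g s)) :=
  Summable.of_norm_bounded hs fun s => by
    rw [norm_mul, Real.norm_of_nonneg (h0 s)]
    exact mul_le_of_le_one_right (h0 s) (abs_cos_le_one _)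

lemma continuous_cosSeries (h0 : ∀ s, 0 ≤ p s) (hs : Summable p) : Continuous (cosSeries p) := by
  unfold cosSeries
  refine (continuous_const.mul (continuous_tsum (fun s => by fun_prop) hs fun s x => ?_)).sub
    continuous_const
  rw [norm_mul, Real.norm_of_nonneg (h0 s)]
  exact mul_le_of_le_one_right (h0 s) (abs_cos_le_one _)

/-- Even cosine series with convex coefficients are nonnegative. -/
lemma cosSeries_nonneg (h0 : ∀ s, 0 ≤ p s) (hs : Summable p)
    (hc : ∀ s, 0 ≤ p s - 2 * p (s + 1) + p (s + 2)) (x : ℝ) : 0 ≤ cosSeries p x := by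
  have hs1 : Summable fun s => p (s + 1) := (summable_nat_add_iff 1).2 hs
  have hs2 : Summable fun s => p (s + 2) := (summable_nat_add_iff 2).2 hs
  rcases (cos_le_one x).lt_or_eq with hx | hx
  -- Summation by parts twice: multiplying by 1 - cos x turns the coefficients into second
  -- differences against the nonnegative 1 - cos((s+1)x).
  · have key : HasSum (fun s : ℕ =>
        (p s - 2 * p (s + 1) + p (s + 2)) * (1 - cos ((s + 1 : ℕ) * x)))
        ((1 - cos x) * cosSeries p x) := by
      have hA := (summable_mul_cos h0 hs (fun s => s * x))
      have hX1 := (summable_mul_cos h0 hs (fun s => (s + 1 : ℕ) * x))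
      have hX3 := (summable_mul_cos (fun s => h0 (s + 2)) hs2 (fun s => (s + 1 : ℕ) * x))
      have hB := (summable_mul_cos (fun s => h0 (s + 1)) hs1 (fun s => (s + 1 : ℕ) * x))
      have eA : ∑' s, p s * cos (s * x) = p 0 + ∑' s, p (s + 1) * cos ((s + 1 : ℕ) * x) := by
        rw [hA.tsum_eq_zero_add]; simp
      have hU := (summable_mul_cos (fun s => h0 (s + 1)) hs1 (fun s => (s + 2 : ℕ) * x))
      have hV := (summable_mul_cos (fun s => h0 (s + 1)) hs1 (fun s => s * x))
      have e1 : ∑' s, p s * cos ((s + 1 : ℕ) * x)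
          = p 0 * cos x + ∑' s, p (s + 1) * cos ((s + 2 : ℕ) * x) := by
        rw [hX1.tsum_eq_zero_add]; simp [add_assoc, one_add_one_eq_two]
      have e2 : ∑' s, p (s + 1) * cos (s * x)
          = p 1 + ∑' s, p (s + 2) * cos ((s + 1 : ℕ) * x) := by
        rw [hV.tsum_eq_zero_add]; simp
      have e3 : ∑' s, p (s + 1) * cos ((s + 2 : ℕ) * x) + ∑' s, p (s + 1) * cos (s * x)
          = 2 * cos x * ∑' s, p (s + 1) * cos ((s + 1 : ℕ) * x) := by
        rw [← hU.tsum_add hV, ← tsum_mul_left]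
        congr 1; ext s
        have a1 : ((s + 2 : ℕ) : ℝ) * x = (s + 1 : ℕ) * x + x := by push_cast; ring
        have a2 : (s : ℝ) * x = (s + 1 : ℕ) * x - x := by push_cast; ring
        rw [a1, a2, cos_add, cos_sub]; ring
      have f0 : ∑' s, p s = p 0 + ∑' s, p (s + 1) := hs.tsum_eq_zero_add
      have f1 : ∑' s, p (s + 1) = p 1 + ∑' s, p (s + 2) := hs1.tsum_eq_zero_add
      have H := (((hs.hasSum.sub (hs1.hasSum.mul_left 2)).add hs2.hasSum).sub
        ((hX1.hasSum.sub (hB.hasSum.mul_left 2)).add hX3.hasSum))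
      have eT : (1 - cos x) * cosSeries p x = ∑' s, p s - 2 * ∑' s, p (s + 1) + ∑' s, p (s + 2)
          - (∑' s, p s * cos ((s + 1 : ℕ) * x) - 2 * ∑' s, p (s + 1) * cos ((s + 1 : ℕ) * x)
            + ∑' s, p (s + 2) * cos ((s + 1 : ℕ) * x)) := by
        unfold cosSeries
        linear_combination (2 * (1 - cos x)) * eA - f0 + f1 + e1 - e2 + e3
      rw [eT]
      refine Eq.mp (congrArg (fun f => HasSum f _) (funext fun s => ?_)) H
      ring
    have h := key.nonneg fun s => mul_nonneg (hc s) (sub_nonneg.2 (cos_le_one _))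
    exact nonneg_of_mul_nonneg_right h (sub_pos.2 hx)
  · obtain ⟨N, rfl⟩ := (cos_eq_one_iff x).1 hx
    have : ∀ s : ℕ, cos (s * (N * (2 * π))) = 1 := fun s => by
      have := cos_int_mul_two_pi (s * N)
      rw [← this]; push_cast; ring_nf
    unfold cosSeries
    simp only [this, mul_one]
    have h1 := hs.le_tsum 0 fun s _ => h0 s
    have := h0 0
    linarith

/-- Termwise integration of Σ p_s cos(st) = (P + p_0)/2; the extra p_0 appears because `cosSeries`
counts its constant term once and the others twice. -/
lemma hasSum_integral_mul_cosSeries (h0 : ∀ s, 0 ≤ p s) (hs : Summable p) {g : ℝ → ℝ}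
    (hg : Continuous g) :
    HasSum (fun s : ℕ => p s * ∫ t in (0 : ℝ)..π, g t * cos (s * t))
      (((∫ t in (0 : ℝ)..π, g t * cosSeries p t) + p 0 * ∫ t in (0 : ℝ)..π, g t) / 2) := by
  have hcs := continuous_cosSeries h0 hs
  have key : HasSum (fun s : ℕ => ∫ t in (0 : ℝ)..π, p s * (g t * cos (s * t)))
      (∫ t in (0 : ℝ)..π, (g t * cosSeries p t + p 0 * g t) / 2) := by
    refine intervalIntegral.hasSum_integral_of_dominated_convergence (fun s t => p s * |g t|)
      (fun s => (by fun_prop : Continuous fun t => p s * (g t * cos (s * t))).aestronglyMeasurable)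
      (fun s => .of_forall fun t _ => ?_) (.of_forall fun t _ => hs.mul_right _) ?_
      (.of_forall fun t _ => ?_)
    · rw [norm_mul, norm_mul, Real.norm_of_nonneg (h0 s)]
      exact mul_le_mul_of_nonneg_left
        (mul_le_of_le_one_right (abs_nonneg _) (abs_cos_le_one _)) (h0 s)
    · simp only [tsum_mul_right]
      exact (by fun_prop : Continuous fun t => (∑' s, p s) * |g t|).intervalIntegrable _ _
    · have e : (g t * cosSeries p t + p 0 * g t) / 2 = g t * ∑' s, p s * cos (s * t) := by
        unfold cosSeries; ring
      rw [e]
      refine Eq.mp (congrArg (fun f => HasSum f _) (funext fun s => ?_))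
        ((summable_mul_cos h0 hs (fun s => s * t)).hasSum.mul_left (g t))
      ring
  rw [intervalIntegral.integral_div, intervalIntegral.integral_add
    ((by fun_prop : Continuous fun t => g t * cosSeries p t).intervalIntegrable _ _)
    ((by fun_prop : Continuous fun t => p 0 * g t).intervalIntegrable _ _),
    intervalIntegral.integral_const_mul] at key
  simpa only [intervalIntegral.integral_const_mul] using key

end cosSeries

lemma integral_cos_const_mul {c : ℝ} (hc : c ≠ 0) (a b : ℝ) :
    ∫ t in a..b, cos (c * t) = (sin (c * b) - sin (c * a)) / c := by
  rw [intervalIntegral.integral_comp_mul_left _ hc, integral_cos, smul_eq_mul]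
  field_simp

lemma integral_cos_int_mul {a : ℤ} (ha : a ≠ 0) : ∫ t in (0 : ℝ)..π, cos (a * t) = 0 := by
  rw [integral_cos_const_mul (by exact_mod_cast ha)]
  simp [sin_int_mul_pi]

lemma integral_cos_mul_cos_of_ne {a b : ℕ} (h : a ≠ b) :
    ∫ t in (0 : ℝ)..π, cos (a * t) * cos (b * t) = 0 := by
  have e : ∀ t : ℝ, cos (a * t) * cos (b * t)
      = (cos (((a + b : ℤ) : ℝ) * t) + cos (((a - b : ℤ) : ℝ) * t)) / 2 := by
    intro t; push_cast; rw [add_mul, sub_mul, cos_add, cos_sub]; ring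
  simp only [e]
  rw [intervalIntegral.integral_div, intervalIntegral.integral_add
    ((by fun_prop : Continuous _).intervalIntegrable _ _)
    ((by fun_prop : Continuous _).intervalIntegrable _ _), integral_cos_int_mul (by omega),
    integral_cos_int_mul (by omega)]
  simp

lemma integral_cos_sq_nat {a : ℕ} (h : a ≠ 0) :
    ∫ t in (0 : ℝ)..π, cos (a * t) * cos (a * t) = π / 2 := by
  have e : ∀ t : ℝ, cos (a * t) * cos (a * t)
      = (1 + cos (((2 * a : ℤ) : ℝ) * t)) / 2 := by
    intro t; push_cast; rw [mul_assoc, cos_two_mul]; ring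
  simp only [e]
  rw [intervalIntegral.integral_div, intervalIntegral.integral_add
    ((by fun_prop : Continuous _).intervalIntegrable _ _)
    ((by fun_prop : Continuous _).intervalIntegrable _ _), integral_cos_int_mul (by omega)]
  simp

lemma integral_cos_mul_cosSeries {p : ℕ → ℝ} (h0 : ∀ s, 0 ≤ p s) (hs : Summable p) (a : ℕ) :
    ∫ t in (0 : ℝ)..π, cos (a * t) * cosSeries p t = π * p a := by
  have H := hasSum_integral_mul_cosSeries h0 hs (g := fun t => cos (a * t)) (by fun_prop)
  have H' := hasSum_single (f := fun s : ℕ => p s * ∫ t in (0 : ℝ)..π, cos (a * t) * cos (s * t)) a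
    (fun s hsa => by rw [integral_cos_mul_cos_of_ne (Ne.symm hsa), mul_zero])
  have := H.unique H'
  rcases eq_or_ne a 0 with rfl | ha
  · simp at this ⊢
    linarith
  · rw [integral_cos_sq_nat ha, show ∫ t in (0 : ℝ)..π, cos (a * t) = 0 from
      integral_cos_int_mul (a := a) (by exact_mod_cast ha)] at this
    linarith

/-! ### The kernel for ν^{-2m} and its L¹ norm. -/

/-- Third differences of negative powers are nonpositive. -/
lemma antitoneOn_second_diff (k : ℕ) :
    AntitoneOn (fun y : ℝ => (y ^ k)⁻¹ - 2 * ((y + 1) ^ k)⁻¹ + ((y + 2) ^ k)⁻¹) (Set.Ioi 0) := by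
  have hd : ∀ y : ℝ, 0 < y → ∀ c : ℝ, 0 ≤ c →
      HasDerivAt (fun y : ℝ => ((y + c) ^ k)⁻¹) (-k * (y + c) ^ (-(k : ℤ) - 1)) y := by
    intro y hy c hc
    have h := (hasDerivAt_zpow (-(k : ℤ)) (y + c) (Or.inl (by positivity))).comp_add_const y c
    simpa using h
  have hD : ∀ y : ℝ, 0 < y →
      HasDerivAt (fun y : ℝ => (y ^ k)⁻¹ - 2 * ((y + 1) ^ k)⁻¹ + ((y + 2) ^ k)⁻¹)
        (-k * y ^ (-(k : ℤ) - 1) - 2 * (-k * (y + 1) ^ (-(k : ℤ) - 1))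
          + -k * (y + 2) ^ (-(k : ℤ) - 1)) y := by
    intro y hy
    have h0 := hd y hy 0 le_rfl
    simp only [add_zero] at h0
    exact (h0.sub ((hd y hy 1 zero_le_one).const_mul 2)).add (hd y hy 2 zero_le_two)
  refine antitoneOn_of_deriv_nonpos (convex_Ioi 0)
    (fun y hy => (hD y hy).continuousAt.continuousWithinAt)
    (fun y hy => (hD y (by simpa using hy)).differentiableAt.differentiableWithinAt) fun y hy => ?_
  have hy : 0 < y := by simpa using hy
  rw [(hD y hy).deriv]
  have hy2 : y + 2 ∈ Set.Ioi (0 : ℝ) := by simp only [Set.mem_Ioi]; linarith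
  have hcz : ConvexOn ℝ (Set.Ioi 0) fun x : ℝ => x ^ (-(k : ℤ) - 1) := convexOn_zpow _
  have hconv := hcz.2 hy hy2 (by norm_num : (0 : ℝ) ≤ 1 / 2) (by norm_num : (0 : ℝ) ≤ 1 / 2)
    (by norm_num)
  simp only [smul_eq_mul] at hconv
  rw [show 1 / 2 * y + 1 / 2 * (y + 2) = y + 1 by ring] at hconv
  have hk : (0 : ℝ) ≤ k := by positivity
  nlinarith

/-- A convex solution of `p s + p (s + 2 n) = 2 (s + n)^{-2m}`. -/
lemma exists_convex_seq {n m : ℕ} (hn : 1 ≤ n) (hm : 1 ≤ m) :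
    ∃ p : ℕ → ℝ, (∀ s, 0 ≤ p s) ∧ Summable p ∧ (∀ s, 0 ≤ p s - 2 * p (s + 1) + p (s + 2)) ∧
      ∀ s, p s + p (s + 2 * n) = 2 * ((s + n : ℝ) ^ (2 * m))⁻¹ := by
  have hn' : (1 : ℝ) ≤ n := by exact_mod_cast hn
  set q : ℝ → ℝ := fun y => (y ^ (2 * m))⁻¹ with hq
  have hq0 : ∀ y, 0 ≤ q y := fun y => by simp only [hq, pow_mul]; positivity
  have hanti : ∀ y z, 0 < y → y ≤ z → q z ≤ q y := fun y z hy hyz => by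
    simp only [hq]; gcongr
  -- This telescoping series both dominates Σ e(y + 4nj) and gives the recursion, since consecutive
  -- blocks of length 2n fill each step of length 4n.
  have htel : ∀ y : ℝ, 0 < y →
      HasSum (fun j : ℕ => q (y + 4 * n * j) - q (y + 4 * n * (j + 1))) (q y) := by
    intro y hy
    have h := hasSum_sub_succ (f := fun j : ℕ => q (y + 4 * n * j)) (fun i j hij => by
      apply hanti _ _ (by positivity); gcongr) (by
        have h1 : Tendsto (fun j : ℕ => y + 4 * n * (j : ℝ)) atTop atTop :=
          tendsto_atTop_add_const_left _ _
            (tendsto_natCast_atTop_atTop.const_mul_atTop (by positivity))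
        exact (tendsto_inv_atTop_zero.comp
          ((tendsto_pow_atTop (by omega : 2 * m ≠ 0)).comp h1)))
    simpa using h
  -- The solution is the alternating sum 2 Σ (-1)^i q(s + n + 2ni), with its terms grouped in pairs
  -- so that it becomes a series of nonnegative terms.
  set e : ℝ → ℝ := fun y => q y - q (y + 2 * n) with he
  have he0 : ∀ y, 0 < y → 0 ≤ e y := fun y hy =>
    sub_nonneg.2 (hanti _ _ hy (by linarith))
  have hse : ∀ y, 0 < y → Summable fun j : ℕ => e (y + 4 * n * j) := fun y hy =>
    Summable.of_nonneg_of_le (fun j => he0 _ (by positivity)) (fun j => by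
      have := hanti (y + 4 * n * j + 2 * n) (y + 4 * n * (j + 1)) (by positivity) (by linarith)
      simp only [he]; linarith) (htel y hy).summable
  have hpos : ∀ s : ℕ, (0 : ℝ) < s + n := fun s => by positivity
  have hp0 : ∀ s : ℕ, 0 ≤ 2 * ∑' j : ℕ, e (s + n + 4 * n * j) := fun s =>
    mul_nonneg zero_le_two (tsum_nonneg fun j => he0 _ (by positivity))
  have hrec : ∀ s : ℕ, 2 * ∑' j : ℕ, e (s + n + 4 * n * j)
      + 2 * ∑' j : ℕ, e ((s + 2 * n : ℕ) + n + 4 * n * j) = 2 * q (s + n) := by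
    intro s
    rw [← (htel (s + n) (hpos s)).tsum_eq, ← mul_add,
      ← (hse _ (hpos s)).tsum_add (hse _ (hpos (s + 2 * n)))]
    congr 2; ext j
    simp only [he]
    push_cast
    ring_nf
  refine ⟨fun s => 2 * ∑' j : ℕ, e (s + n + 4 * n * j), hp0, ?_, fun s => ?_, hrec⟩
  · have h2 : Summable fun s : ℕ => 2 * (1 / ((s + 1 : ℕ) : ℝ) ^ 2) :=
      ((summable_nat_add_iff 1).2 (Real.summable_one_div_nat_pow.2 one_lt_two)).mul_left 2
    refine Summable.of_nonneg_of_le hp0 (fun s => ?_) h2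
    have h3 := hrec s
    have h4 := hp0 (s + 2 * n)
    have h5 : q (s + n) ≤ 1 / ((s + 1 : ℕ) : ℝ) ^ 2 := by
      simp only [hq, one_div]
      have h6 : (1 : ℝ) ≤ s + n := by have := s.cast_nonneg (α := ℝ); linarith
      gcongr
      calc ((s + 1 : ℕ) : ℝ) ^ 2 ≤ (s + n : ℝ) ^ 2 := by push_cast; gcongr
        _ ≤ (s + n : ℝ) ^ (2 * m) := pow_le_pow_right₀ h6 (by omega)
    linarith
  · have h1 : ∀ c : ℕ, Summable fun j : ℕ => e ((s + c : ℕ) + n + 4 * n * j) :=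
      fun c => hse _ (hpos (s + c))
    have h10 := h1 0
    simp only [add_zero] at h10
    have : 2 * ∑' j : ℕ, e (s + n + 4 * n * j) - 2 * (2 * ∑' j : ℕ, e ((s + 1 : ℕ) + n + 4 * n * j))
        + 2 * ∑' j : ℕ, e ((s + 2 : ℕ) + n + 4 * n * j)
        = 2 * ∑' j : ℕ, (e (s + n + 4 * n * j) - 2 * e ((s + 1 : ℕ) + n + 4 * n * j)
          + e ((s + 2 : ℕ) + n + 4 * n * j)) := by
      rw [(h10.sub ((h1 1).mul_left 2)).tsum_add (h1 2), h10.tsum_sub ((h1 1).mul_left 2),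
        tsum_mul_left]
      ring
    rw [this]
    refine mul_nonneg zero_le_two (tsum_nonneg fun j => ?_)
    have hy : (0 : ℝ) < s + n + 4 * n * j := by positivity
    -- The second difference of `e` is that of `q` at y minus that at y + 2n, so convexity of p
    -- rests on third differences of `q`.
    have := antitoneOn_second_diff (2 * m) (a := (s + n + 4 * n * j : ℝ)) hy
      (b := s + n + 4 * n * j + 2 * n) (by simp only [Set.mem_Ioi]; positivity) (by linarith)
    simp only [he, hq]
    push_cast
    ring_nf at this ⊢
    linarith

lemma integral_neg_self_of_even {f : ℝ → ℝ} (hf : Continuous f) (he : ∀ x, f (-x) = f x) {a : ℝ} :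
    ∫ x in (-a)..a, f x = 2 * ∫ x in (0 : ℝ)..a, f x := by
  rw [← intervalIntegral.integral_add_adjacent_intervals (hf.intervalIntegrable (-a) 0)
    (hf.intervalIntegrable 0 a)]
  have := intervalIntegral.integral_comp_neg (a := (0 : ℝ)) (b := a) f
  simp only [he, neg_zero] at this
  rw [← this]; ring

lemma isCircleFun_abs_cos (n : ℕ) : IsCircleFun fun x => |cos (n * x)| := by
  have : IsCircleFun fun x => cos (n * x) := IsHarmonic.isCircleFun (Or.inl rfl)
  exact ⟨this.1.abs, fun x => congrArg abs (this.2 x)⟩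

lemma integral_abs_cos_mul_cos (n s : ℕ) :
    ∫ t in (0 : ℝ)..π, |cos (n * t)| * cos (s * t)
      = pair (fun x => |cos (n * x)|) (fun x => cos (s * x)) / 2 := by
  unfold pair
  rw [integral_neg_self_of_even (by fun_prop) fun x => by simp [mul_neg]]
  ring

/-- |cos nt| is invariant under shifts by ±π/n, so `pair_shift` forces the coefficient to vanish
unless cos(sπ/n) = 1. -/
lemma integral_abs_cos_mul_cos_eq_zero {n s : ℕ} (hn : 1 ≤ n) (hs : ¬ 2 * n ∣ s) :
    ∫ t in (0 : ℝ)..π, |cos (n * t)| * cos (s * t) = 0 := by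
  have hn' : (n : ℝ) ≠ 0 := by positivity
  rw [integral_abs_cos_mul_cos]
  have h := pair_shift (isCircleFun_abs_cos n) (Or.inl rfl : IsHarmonic s fun x => cos (s * x))
    (π / n)
  have e1 : ∀ x : ℝ, n * (x + π / n) = n * x + π := fun x => by field_simp
  have e2 : ∀ x : ℝ, n * (x - π / n) = n * x - π := fun x => by field_simp
  have e3 : (fun x : ℝ => |cos (n * (x + π / n))| + |cos (n * (x - π / n))|)
      = fun x => 2 * |cos (n * x)| := by
    ext x
    rw [e1, e2, cos_add_pi, cos_sub_pi, abs_neg]; ring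
  rw [e3, pair_const_mul] at h
  have hc : cos (s * (π / n)) ≠ 1 := by
    intro hc
    obtain ⟨N, hN⟩ := (cos_eq_one_iff _).1 hc
    have : (s : ℝ) = 2 * n * N := by
      field_simp at hN
      linarith
    apply hs
    have h2 : (s : ℤ) = (2 * n : ℕ) * N := by exact_mod_cast this
    exact_mod_cast Dvd.intro _ h2.symm
  have : (1 - cos (s * (π / n))) * pair (fun x => |cos (n * x)|) (fun x => cos (s * x)) = 0 := by
    linarith
  rcases mul_eq_zero.1 this with h | h
  · exact absurd (by linarith) hc
  · rw [h, zero_div]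

/-- Rescaling by n and π-periodicity reduce the integral to the single arch [-π/2, π/2], where the
cosine is nonnegative and the absolute value disappears. -/
lemma integral_abs_cos_mul_cos_two_mul {n : ℕ} (hn : 1 ≤ n) (j : ℕ) :
    ∫ t in (0 : ℝ)..π, |cos (n * t)| * cos ((2 * n * j : ℕ) * t)
      = 2 * (-1) ^ (j + 1) / (4 * j ^ 2 - 1) := by
  have hn' : (n : ℝ) ≠ 0 := by positivity
  rw [integral_abs_cos_mul_cos]
  set H : ℝ → ℝ := fun y => |cos y| * cos ((2 * j : ℕ) * y) with hH
  have hHc : Continuous H := by fun_prop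
  have hper : Function.Periodic H π := by
    intro y
    simp only [hH]
    rw [cos_add_pi, abs_neg]
    have : ((2 * j : ℕ) : ℝ) * (y + π) = (2 * j : ℕ) * y + j * (2 * π) := by push_cast; ring
    rw [this, cos_add_nat_mul_two_pi]
  have e1 : pair (fun x => |cos (n * x)|) (fun x => cos ((2 * n * j : ℕ) * x))
      = ∫ x in (-π)..π, H (n * x) := by
    unfold pair
    congr 1; ext x
    simp only [hH]
    congr 2; push_cast; ring
  have e2 : ∫ x in (-π)..π, H (n * x) = 2 * ∫ y in (-(π / 2))..(π / 2), H y := by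
    rw [intervalIntegral.integral_comp_mul_left _ hn']
    have h1 := hper.intervalIntegral_add_zsmul_eq (2 * n : ℕ) (n * -π)
      (fun _ _ => hHc.intervalIntegrable _ _)
    have h2 := hper.intervalIntegral_add_eq (n * -π) (-(π / 2))
    have b1 : (n : ℝ) * -π + ((2 * n : ℕ) : ℤ) • π = n * π := by
      rw [zsmul_eq_mul]; push_cast; ring
    have b2 : -(π / 2) + π = π / 2 := by ring
    rw [b1] at h1
    rw [b2] at h2
    rw [h1, h2, smul_eq_mul, zsmul_eq_mul]
    push_cast
    field_simp
  have e3 : ∫ y in (-(π / 2))..(π / 2), H y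
      = ∫ y in (-(π / 2))..(π / 2), (cos ((2 * j + 1 : ℝ) * y) + cos ((2 * j - 1 : ℝ) * y)) / 2 := by
    apply intervalIntegral.integral_congr
    intro y hy
    rw [Set.uIcc_of_le (by linarith [pi_pos])] at hy
    simp only [hH]
    rw [abs_of_nonneg (cos_nonneg_of_mem_Icc hy), add_mul, sub_mul, one_mul, cos_add, cos_sub]
    push_cast; ring
  have n1 : (2 * j + 1 : ℝ) ≠ 0 := by positivity
  have n2 : (2 * j - 1 : ℝ) ≠ 0 := by
    intro h
    have : (2 * j : ℝ) = 1 := by linarith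
    have : 2 * j = 1 := by exact_mod_cast this
    omega
  have s1 : sin ((2 * j + 1 : ℝ) * (π / 2)) = (-1) ^ j := by
    rw [show (2 * j + 1 : ℝ) * (π / 2) = π / 2 + j * π by ring, sin_add_nat_mul_pi]; simp
  have s2 : sin ((2 * j - 1 : ℝ) * (π / 2)) = -(-1) ^ j := by
    rw [show (2 * j - 1 : ℝ) * (π / 2) = -(π / 2) + j * π by ring, sin_add_nat_mul_pi]; simp
  rw [e1, e2, e3, intervalIntegral.integral_div, intervalIntegral.integral_add
    ((by fun_prop : Continuous _).intervalIntegrable _ _)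
    ((by fun_prop : Continuous _).intervalIntegrable _ _), integral_cos_const_mul n1,
    integral_cos_const_mul n2, mul_neg, mul_neg, sin_neg, sin_neg, s1, s2, pow_succ,
    show (4 * j ^ 2 - 1 : ℝ) = (2 * j + 1) * (2 * j - 1) by ring]
  field_simp
  ring

/-- The `L¹` norm of `cos (n ·)` times a convex cosine series. -/
lemma integral_abs_cos_mul_cosSeries_le {p : ℕ → ℝ} {n : ℕ} (hn : 1 ≤ n) (h0 : ∀ s, 0 ≤ p s)
    (hs : Summable p) (hanti : Antitone p) :
    ∫ t in (0 : ℝ)..π, |cos (n * t)| * cosSeries p t ≤ 2 * (p 0 + p (2 * n)) := by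
  have H := hasSum_integral_mul_cosSeries h0 hs (g := fun t => |cos (n * t)|) (by fun_prop)
  have hinj : Function.Injective fun j : ℕ => 2 * n * j := fun i j hij =>
    Nat.eq_of_mul_eq_mul_left (by omega) hij
  rw [← hinj.hasSum_iff (fun s hs => by
    rw [integral_abs_cos_mul_cos_eq_zero hn, mul_zero]
    rintro ⟨j, rfl⟩
    exact hs ⟨j, rfl⟩)] at H
  have hI := integral_abs_cos_mul_cos_two_mul hn 0
  simp at hI
  rw [hI] at H
  -- The right side is the sum of the j = 0 and j = 1 terms. From j = 2 on, the terms alternate with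
  -- decreasing size starting from a nonpositive one, so the tail only helps.
  have hle : ((∫ t in (0 : ℝ)..π, |cos (n * t)| * cosSeries p t) + p 0 * 2) / 2
      ≤ 2 * p 0 + 2 / 3 * p (2 * n) := by
    refine le_of_tendsto' ((tendsto_add_atTop_iff_nat 2).2 H.tendsto_sum_nat) fun N => ?_
    set b : ℕ → ℝ := fun i => p (2 * n * (i + 2)) * (2 / (4 * (i + 2 : ℝ) ^ 2 - 1)) with hb
    have hpos : ∀ i : ℕ, (0 : ℝ) < 4 * (i + 2 : ℝ) ^ 2 - 1 := fun i => by
      have : (0 : ℝ) ≤ i := i.cast_nonneg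
      nlinarith
    have hb0 : ∀ i, 0 ≤ b i := fun i =>
      mul_nonneg (h0 _) (div_nonneg zero_le_two (hpos i).le)
    have hba : Antitone b := fun i j hij => by
      have hij' : (i : ℝ) ≤ j := by exact_mod_cast hij
      refine mul_le_mul (hanti (Nat.mul_le_mul_left _ (by omega))) ?_
        (div_nonneg zero_le_two (hpos j).le) (h0 _)
      have := hpos i
      gcongr
    have halt := alternating_sum_nonneg hba hb0 N
    rw [Finset.sum_range_succ', Finset.sum_range_succ']
    simp only [Function.comp_apply, integral_abs_cos_mul_cos_two_mul hn]
    have : ∑ i ∈ Finset.range N, p (2 * n * (i + 1 + 1)) *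
        (2 * (-1) ^ (i + 1 + 1 + 1) / (4 * ((i + 1 + 1 : ℕ) : ℝ) ^ 2 - 1))
        = - ∑ i ∈ Finset.range N, (-1) ^ i * b i := by
      rw [← Finset.sum_neg_distrib]
      refine Finset.sum_congr rfl fun i _ => ?_
      simp only [hb]
      push_cast
      rw [show (i : ℝ) + 1 + 1 = i + 2 by ring]
      ring
    rw [this]
    norm_num
    linarith
  have := h0 (2 * n)
  linarith

/-- The differences p_s - p_{s+1} decrease to 0, hence are nonnegative. -/
lemma antitone_of_convex {p : ℕ → ℝ} (hs : Summable p)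
    (hc : ∀ s, 0 ≤ p s - 2 * p (s + 1) + p (s + 2)) : Antitone p := by
  have hd : Antitone fun s => p s - p (s + 1) := antitone_nat_of_succ_le fun s => by
    have := hc s
    linarith
  have ht : Tendsto (fun s => p s - p (s + 1)) atTop (𝓝 0) := by
    simpa using hs.tendsto_atTop_zero.sub ((tendsto_add_atTop_iff_nat 1).2 hs.tendsto_atTop_zero)
  exact antitone_nat_of_succ_le fun s => sub_nonneg.1 (hd.le_of_tendsto ht s)

/-- A kernel with multiplier `ν^{-2m}` at all frequencies `ν ≥ n`, of `L¹` norm at most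
`(4 / π) n^{-2m}`. -/
lemma exists_kernel {n m : ℕ} (hn : 1 ≤ n) (hm : 1 ≤ m) :
    ∃ κ : ℝ → ℝ, Continuous κ ∧
      (∀ ν : ℕ, n ≤ ν → ∫ t in (0 : ℝ)..π, κ t * (2 * cos (ν * (1 * t))) = ((ν : ℝ) ^ (2 * m))⁻¹) ∧
      ∫ t in (0 : ℝ)..π, |κ t| * 2 ≤ 4 / π * ((n : ℝ) ^ (2 * m))⁻¹ := by
  obtain ⟨p, h0, hs, hc, hrec⟩ := exists_convex_seq hn hm
  have hP := continuous_cosSeries h0 hs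
  refine ⟨fun t => cos (n * t) * cosSeries p t / (2 * π), by fun_prop, fun ν hν => ?_, ?_⟩
  · obtain ⟨s, rfl⟩ := Nat.exists_eq_add_of_le hν
    -- The factor cos(nt) splits frequency ν = n + s into ν - n = s and ν + n = s + 2n, which is
    -- what the recursion for `p` is designed to match.
    have e : ∀ t : ℝ, cos (n * t) * cosSeries p t / (2 * π) * (2 * cos ((n + s : ℕ) * (1 * t)))
        = (cos (s * t) * cosSeries p t + cos ((s + 2 * n : ℕ) * t) * cosSeries p t) / (2 * π) := by
      intro t
      have a1 : (s : ℝ) * t = (n + s : ℕ) * (1 * t) - n * t := by push_cast; ring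
      have a2 : ((s + 2 * n : ℕ) : ℝ) * t = (n + s : ℕ) * (1 * t) + n * t := by push_cast; ring
      rw [a1, a2, cos_add, cos_sub]
      ring
    simp only [e]
    rw [intervalIntegral.integral_div, intervalIntegral.integral_add
      ((by fun_prop : Continuous _).intervalIntegrable _ _)
      ((by fun_prop : Continuous _).intervalIntegrable _ _), integral_cos_mul_cosSeries h0 hs,
      integral_cos_mul_cosSeries h0 hs, ← mul_add, hrec]
    push_cast
    rw [add_comm (n : ℝ)]
    field_simp
  · have e : ∀ t : ℝ, |cos (n * t) * cosSeries p t / (2 * π)| * 2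
        = |cos (n * t)| * cosSeries p t / π := by
      intro t
      rw [abs_div, abs_mul, abs_of_nonneg (cosSeries_nonneg h0 hs hc t),
        abs_of_pos (by positivity : 0 < 2 * π)]
      field_simp
    simp only [e]
    rw [intervalIntegral.integral_div]
    have h := integral_abs_cos_mul_cosSeries_le hn h0 hs (antitone_of_convex hs hc)
    have h2 := hrec 0
    simp only [zero_add, Nat.cast_zero] at h2
    rw [h2] at h
    calc _ ≤ 2 * (2 * ((n : ℝ) ^ (2 * m))⁻¹) / π := by gcongr
      _ = _ := by ring

/-! ### Binomial ratios and the size of 1 - μ². -/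

lemma choose_two_mul_self_pos (k : ℕ) : (0 : ℝ) < (2 * k).choose k := by
  exact_mod_cast Nat.choose_pos (by omega)

lemma binomRatio_nonneg (k i : ℕ) : 0 ≤ binomRatio k i := by unfold binomRatio; positivity

lemma binomRatio_zero (k : ℕ) : binomRatio k 0 = 1 :=
  div_self (choose_two_mul_self_pos k).ne'

lemma binomRatio_eq_zero {k i : ℕ} (h : k < i) : binomRatio k i = 0 := by
  unfold binomRatio
  rw [Nat.choose_eq_zero_of_lt (by omega)]
  simp

lemma binomRatio_succ (k i : ℕ) :
    binomRatio k (i + 1) * (k + i + 1) = binomRatio k i * (k - i) := by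
  rcases lt_or_ge k i with h | h
  · rw [binomRatio_eq_zero h, binomRatio_eq_zero (by omega)]; simp
  · have h1 := Nat.choose_succ_right_eq (2 * k) (k + i)
    rw [show 2 * k - (k + i) = k - i by omega] at h1
    have h2 : ((2 * k).choose (k + i + 1) : ℝ) * (k + i + 1) = (2 * k).choose (k + i) * (k - i) := by
      rw [← Nat.cast_sub h]; exact_mod_cast h1
    unfold binomRatio
    rw [div_mul_eq_mul_div, div_mul_eq_mul_div, ← h2, add_assoc k i 1]

lemma antitone_binomRatio (k : ℕ) : Antitone (binomRatio k) := by
  refine antitone_nat_of_succ_le fun i => ?_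
  have h := binomRatio_succ k i
  have h0 := binomRatio_nonneg k i
  have h1 := binomRatio_nonneg k (i + 1)
  have hk : (0 : ℝ) ≤ k := k.cast_nonneg
  have hi : (0 : ℝ) ≤ i := i.cast_nonneg
  by_contra! hlt
  nlinarith [mul_nonneg h0 hi, mul_nonneg h1 hi, mul_nonneg h1 hk]

/-- Together with `sub_sq_le_binomRatio_mul`, this makes (1 - a_i)/i² comparable to 1/(k + i²). Both
follow by induction from a_{i+1}/a_i = (k - i)/(k + i + 1). -/
lemma binomRatio_mul_le (k i : ℕ) : binomRatio k i * (k + i ^ 2) ≤ k := by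
  induction i with
  | zero => simp [binomRatio_zero]
  | succ i ih =>
    have h := binomRatio_succ k i
    have h0 := binomRatio_nonneg k i
    have hk : (0 : ℝ) ≤ k := k.cast_nonneg
    have hi : (0 : ℝ) ≤ i := i.cast_nonneg
    refine le_of_mul_le_mul_right ?_ (by positivity : (0 : ℝ) < k + i + 1)
    calc binomRatio k (i + 1) * (k + ((i + 1 : ℕ) : ℝ) ^ 2) * (k + i + 1)
        = binomRatio k i * ((k - i) * (k + (i + 1) ^ 2)) := by
          push_cast; linear_combination (k + (i + 1 : ℝ) ^ 2) * h
      _ ≤ binomRatio k i * ((k + i ^ 2) * (k + i + 1)) := by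
          refine mul_le_mul_of_nonneg_left ?_ h0
          nlinarith [mul_nonneg hi hi, mul_nonneg hi (mul_nonneg hi hi)]
      _ = binomRatio k i * (k + i ^ 2) * (k + i + 1) := by ring
      _ ≤ k * (k + i + 1) := by gcongr

lemma sub_sq_le_binomRatio_mul (k i : ℕ) : (k : ℝ) - i ^ 2 ≤ binomRatio k i * k := by
  induction i with
  | zero => simp [binomRatio_zero]
  | succ i ih =>
    have hk : (0 : ℝ) ≤ k := k.cast_nonneg
    have hi : (0 : ℝ) ≤ i := i.cast_nonneg
    rcases lt_or_ge i k with hik | hik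
    · have h := binomRatio_succ k i
      have hik' : (i : ℝ) ≤ k := by exact_mod_cast hik.le
      refine le_of_mul_le_mul_right ?_ (by positivity : (0 : ℝ) < k + i + 1)
      calc ((k : ℝ) - ((i + 1 : ℕ) : ℝ) ^ 2) * (k + i + 1) ≤ (k - i ^ 2) * (k - i) := by
            push_cast
            nlinarith [mul_nonneg hi hi, mul_nonneg hi (mul_nonneg hi hi)]
        _ ≤ binomRatio k i * k * (k - i) :=
            mul_le_mul_of_nonneg_right ih (sub_nonneg.2 hik')
        _ = binomRatio k (i + 1) * k * (k + i + 1) := by linear_combination -(k : ℝ) * h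
    · have h1 := mul_nonneg (binomRatio_nonneg k (i + 1)) hk
      have : (k : ℝ) ≤ i := by exact_mod_cast hik
      push_cast
      nlinarith

lemma hasSum_one_div_odd_sq : HasSum (fun j : ℕ => 1 / ((2 * j + 1 : ℕ) : ℝ) ^ 2) (π ^ 2 / 8) := by
  have hz := hasSum_zeta_two
  have he : HasSum (fun j : ℕ => 1 / ((2 * j : ℕ) : ℝ) ^ 2) (π ^ 2 / 24) := by
    have := hz.mul_left (1 / 4)
    rw [show π ^ 2 / 24 = 1 / 4 * (π ^ 2 / 6) by ring]
    refine Eq.mp (congrArg (fun f => HasSum f _) (funext fun j => ?_)) this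
    push_cast
    rw [mul_pow, one_div_mul_one_div]; norm_num
  have ho : Summable (fun j : ℕ => 1 / ((2 * j + 1 : ℕ) : ℝ) ^ 2) :=
    hz.summable.comp_injective (fun i j h => by simpa using h)
  have h := (he.even_add_odd (f := fun n : ℕ => 1 / (n : ℝ) ^ 2) ho.hasSum).unique hz
  rw [show π ^ 2 / 8 = ∑' j : ℕ, 1 / ((2 * j + 1 : ℕ) : ℝ) ^ 2 by linarith]
  exact ho.hasSum

/-- The ratios vanish for i > k, so the finite sum is a full series over odd i and can be subtracted
termwise from Σ 1/i² = π²/8. -/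
lemma hasSum_muSq (k : ℕ) : HasSum
    (fun j : ℕ => 8 / π ^ 2 * (binomRatio k (2 * j + 1) / ((2 * j + 1 : ℕ) : ℝ) ^ 2)) (muSq k) := by
  refine HasSum.mul_left _ ?_
  have h := hasSum_sum_of_ne_finset_zero (L := .unconditional ℕ) (s := Finset.Icc 1 k)
    (f := fun i : ℕ => if Odd i then binomRatio k i / (i : ℝ) ^ 2 else 0) (fun i hi => by
      rw [Finset.mem_Icc] at hi
      split_ifs with ho
      · have := ho.pos
        rw [binomRatio_eq_zero (by omega), zero_div]
      · rfl)
  rw [← Finset.sum_filter] at h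
  have hinj : Function.Injective fun j : ℕ => 2 * j + 1 := fun i j hij => by simpa using hij
  rw [← hinj.hasSum_iff (fun i hi => if_neg fun ho => by
    obtain ⟨j, rfl⟩ := ho
    exact hi ⟨j, rfl⟩)] at h
  refine Eq.mp (congrArg (fun f => HasSum f _) (funext fun j => ?_)) h
  simp

lemma hasSum_one_sub_muSq (k : ℕ) : HasSum
    (fun j : ℕ => 8 / π ^ 2 * ((1 - binomRatio k (2 * j + 1)) / ((2 * j + 1 : ℕ) : ℝ) ^ 2))
    (1 - muSq k) := by
  have h := (hasSum_one_div_odd_sq.mul_left (8 / π ^ 2)).sub (hasSum_muSq k)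
  rw [show 8 / π ^ 2 * (π ^ 2 / 8) = 1 by field_simp] at h
  refine Eq.mp (congrArg (fun f => HasSum f _) (funext fun j => ?_)) h
  ring

lemma muSq_nonneg (k : ℕ) : 0 ≤ muSq k :=
  (hasSum_muSq k).nonneg fun j => by have := binomRatio_nonneg k (2 * j + 1); positivity

lemma one_div_le_one_sub_binomRatio_div {k i : ℕ} (hi : 1 ≤ i) :
    1 / (k + i ^ 2 : ℝ) ≤ (1 - binomRatio k i) / (i : ℝ) ^ 2 := by
  have h := binomRatio_mul_le k i
  rw [div_le_div_iff₀ (by positivity) (by positivity)]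
  linarith

lemma one_sub_binomRatio_div_le {k i : ℕ} (hk : 1 ≤ k) (hi : 1 ≤ i) :
    (1 - binomRatio k i) / (i : ℝ) ^ 2 ≤ 2 / (k + i ^ 2 : ℝ) := by
  have h := sub_sq_le_binomRatio_mul k i
  have h0 := binomRatio_nonneg k i
  have hi2 : (0 : ℝ) < i ^ 2 := by positivity
  rw [div_le_div_iff₀ (by positivity) (by positivity)]
  nlinarith [mul_nonneg h0 hi2.le]

lemma one_sub_muSq_ge {k : ℕ} (hk : 1 ≤ k) : 8 / π ^ 2 * (1 / (10 * √k)) ≤ 1 - muSq k := by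
  have hs := hasSum_one_sub_muSq k
  have hk0 : (0 : ℝ) < k := by exact_mod_cast hk
  have hsq : √(k : ℝ) ^ 2 = k := sq_sqrt hk0.le
  have hsp : 0 < √(k : ℝ) := sqrt_pos.2 hk0
  -- Keep the first ⌊√k⌋ terms: there i = 2j + 1 ≤ 2⌊√k⌋, so k + i² ≤ 5k, and ⌊√k⌋ ≥ √k/2.
  set s := Nat.sqrt k
  have hs1 : (1 : ℝ) ≤ s := by exact_mod_cast Nat.sqrt_pos.2 hk
  have hsk : (s : ℝ) ^ 2 ≤ k := by exact_mod_cast Nat.sqrt_le' k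
  have hsl : √(k : ℝ) ≤ s + 1 := by
    rw [sqrt_le_left (by positivity)]
    exact_mod_cast (Nat.lt_succ_sqrt' k).le
  refine le_trans ?_ (sum_le_hasSum (Finset.range s) (fun j _ => ?_) hs)
  · calc 8 / π ^ 2 * (1 / (10 * √k)) ≤ ∑ _j ∈ Finset.range s, 8 / π ^ 2 * (1 / (5 * k : ℝ)) := by
          rw [Finset.sum_const, Finset.card_range, nsmul_eq_mul]
          have : 1 / (10 * √k) ≤ s * (1 / (5 * k : ℝ)) := by
            rw [mul_one_div, div_le_div_iff₀ (by positivity) (by positivity)]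
            nlinarith
          calc _ ≤ 8 / π ^ 2 * (s * (1 / (5 * k : ℝ))) := by gcongr
            _ = _ := by ring
      _ ≤ _ := by
          refine Finset.sum_le_sum fun j hj => ?_
          have hj : (j : ℝ) + 1 ≤ s := by exact_mod_cast Finset.mem_range.1 hj
          refine mul_le_mul_of_nonneg_left ?_ (by positivity)
          refine le_trans ?_ (one_div_le_one_sub_binomRatio_div (by omega))
          apply one_div_le_one_div_of_le (by positivity)
          push_cast
          have : (0 : ℝ) ≤ j := j.cast_nonneg
          nlinarith
  · have := (one_div_le_one_sub_binomRatio_div (k := k) (i := 2 * j + 1) (by omega)).trans'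
      (by positivity)
    positivity

lemma muSq_lt_one {k : ℕ} (hk : 1 ≤ k) : muSq k < 1 := by
  have hk0 : (0 : ℝ) < k := by exact_mod_cast hk
  have hsp : 0 < √(k : ℝ) := sqrt_pos.2 hk0
  have : 0 < 8 / π ^ 2 * (1 / (10 * √k)) := by positivity
  linarith [one_sub_muSq_ge hk]

lemma one_sub_muSq_le {k : ℕ} (hk : 1 ≤ k) : 1 - muSq k ≤ 8 / π ^ 2 * (2 / √k) := by
  have hk0 : (0 : ℝ) < k := by exact_mod_cast hk
  have hsq : √(k : ℝ) ^ 2 = k := sq_sqrt hk0.le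
  have hsp : 0 < √(k : ℝ) := sqrt_pos.2 hk0
  set R := √(k : ℝ)
  -- Telescoping majorant: with i = 2j + 1, its terms are 4/((R + i)² - 1), and (R + i)² ≤ 2(R² +
  -- i²) makes them at least 2/(k + i²).
  have ht := (hasSum_sub_succ (f := fun j : ℕ => 2 / (R + 2 * j)) (fun i j hij => by
    have hij' : (i : ℝ) ≤ j := by exact_mod_cast hij
    exact div_le_div_of_nonneg_left zero_le_two (by positivity) (by linarith)) (by
    have h1 : Tendsto (fun j : ℕ => R + 2 * (j : ℝ)) atTop atTop :=
      tendsto_atTop_add_const_left _ _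
        (tendsto_natCast_atTop_atTop.const_mul_atTop (by positivity))
    exact h1.const_div_atTop 2)).mul_left (8 / π ^ 2)
  simp only [Nat.cast_zero, mul_zero, add_zero] at ht
  refine hasSum_le (fun j => mul_le_mul_of_nonneg_left ?_ (by positivity))
    (hasSum_one_sub_muSq k) ht
  refine (one_sub_binomRatio_div_le hk (by omega)).trans ?_
  have hj : (0 : ℝ) ≤ j := j.cast_nonneg
  push_cast
  rw [← hsq, div_sub_div _ _ (by positivity) (by positivity),
    div_le_div_iff₀ (by positivity) (by positivity)]
  nlinarith [sq_nonneg (R - (2 * j + 1))]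

/-! ### Central binomial coefficients and the two asymptotic relations. -/

lemma gammaStar_two_mul (k : ℕ) : gammaStar (2 * k) = 1 / ((2 * k).choose k : ℝ) := by
  unfold gammaStar
  rw [Nat.mul_div_cancel_left k two_pos]

lemma gammaStar_pos (k : ℕ) : 0 < gammaStar (2 * k) := by
  rw [gammaStar_two_mul]
  exact one_div_pos.2 (choose_two_mul_self_pos k)

lemma choose_succ_mul (k : ℕ) :
    ((k : ℝ) + 1) * (2 * (k + 1)).choose (k + 1) = 2 * (2 * k + 1) * (2 * k).choose k := by
  have := Nat.succ_mul_centralBinom_succ k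
  unfold Nat.centralBinom at this
  exact_mod_cast this

/-- The weight 2k + 1 lets the induction close through (2k+1)(2k+3) ≤ (2k+2)²; the weight 4k in
`le_choose_sq` works through 4k(k+1) ≤ (2k+1)². -/
lemma choose_sq_le (k : ℕ) : ((2 * k).choose k : ℝ) ^ 2 * (2 * k + 1) ≤ 16 ^ k := by
  induction k with
  | zero => simp
  | succ k ih =>
    have h := choose_succ_mul k
    set A := ((2 * (k + 1)).choose (k + 1) : ℝ)
    set B := ((2 * k).choose k : ℝ)
    have hk : (0 : ℝ) ≤ k := k.cast_nonneg
    refine le_of_mul_le_mul_left ?_ (by positivity : (0 : ℝ) < (k + 1) ^ 2)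
    calc ((k : ℝ) + 1) ^ 2 * (A ^ 2 * (2 * ((k + 1 : ℕ) : ℝ) + 1))
        = ((k + 1) * A) ^ 2 * (2 * k + 3) := by push_cast; ring
      _ = B ^ 2 * (2 * k + 1) * (4 * ((2 * k + 1) * (2 * k + 3))) := by rw [h]; ring
      _ ≤ 16 ^ k * (4 * (4 * (k + 1) ^ 2)) := by
          gcongr ?_ * (4 * ?_)
          nlinarith
      _ = _ := by ring

lemma le_choose_sq {k : ℕ} (hk : 1 ≤ k) : (16 : ℝ) ^ k ≤ ((2 * k).choose k : ℝ) ^ 2 * (4 * k) := by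
  induction k, hk using Nat.le_induction with
  | base => norm_num
  | succ k hk ih =>
    have h := choose_succ_mul k
    set A := ((2 * (k + 1)).choose (k + 1) : ℝ)
    set B := ((2 * k).choose k : ℝ)
    have hk : (0 : ℝ) ≤ k := k.cast_nonneg
    refine le_of_mul_le_mul_left ?_ (by positivity : (0 : ℝ) < (k + 1))
    calc ((k : ℝ) + 1) * 16 ^ (k + 1) = 16 ^ k * (16 * (k + 1)) := by ring
      _ ≤ B ^ 2 * (4 * k) * (16 * (k + 1)) := by gcongr
      _ ≤ (2 * (2 * k + 1) * B) ^ 2 * 4 := by nlinarith [sq_nonneg B]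
      _ = _ := by rw [← h]; push_cast; ring

lemma gammaStar_div_asymp : ∃ c C : ℝ, 0 < c ∧ 0 < C ∧ ∀ k : ℕ, 1 ≤ k →
    c * (√((2 * k : ℕ) : ℝ) * gammaStar (2 * k)) ≤ gammaStar (2 * k) / (1 - muSq k) ∧
    gammaStar (2 * k) / (1 - muSq k) ≤ C * (√((2 * k : ℕ) : ℝ) * gammaStar (2 * k)) := by
  refine ⟨π ^ 2 / (16 * √2), 10 * π ^ 2 / (8 * √2), by positivity, by positivity, fun k hk => ?_⟩
  have hk0 : (0 : ℝ) < k := by exact_mod_cast hk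
  have hsp : 0 < √(k : ℝ) := sqrt_pos.2 hk0
  have hg := gammaStar_pos k
  have h1 := one_sub_muSq_ge hk
  have h2 := one_sub_muSq_le hk
  have h3 : 0 < 1 - muSq k := sub_pos.2 (muSq_lt_one hk)
  have hs2 : √((2 * k : ℕ) : ℝ) = √2 * √k := by push_cast; exact sqrt_mul zero_le_two _
  have h4 : 0 < √(2 : ℝ) := by positivity
  rw [hs2]
  constructor
  · calc _ = gammaStar (2 * k) / (8 / π ^ 2 * (2 / √k)) := by field_simp; ring
      _ ≤ _ := by gcongr
  · calc _ ≤ gammaStar (2 * k) / (8 / π ^ 2 * (1 / (10 * √k))) := by gcongr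
      _ = _ := by field_simp

lemma sqrt_mul_gammaStar_asymp : ∃ c C : ℝ, 0 < c ∧ 0 < C ∧ ∀ k : ℕ, 1 ≤ k →
    c * (((2 * k : ℕ) : ℝ) / 2 ^ (2 * k)) ≤ √((2 * k : ℕ) : ℝ) * gammaStar (2 * k) ∧
    √((2 * k : ℕ) : ℝ) * gammaStar (2 * k) ≤ C * (((2 * k : ℕ) : ℝ) / 2 ^ (2 * k)) := by
  refine ⟨1, 2, one_pos, two_pos, fun k hk => ?_⟩
  have hk0 : (0 : ℝ) < (2 * k : ℕ) := by exact_mod_cast (by omega : 0 < 2 * k)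
  have hsq : √((2 * k : ℕ) : ℝ) ^ 2 = (2 * k : ℕ) := sq_sqrt hk0.le
  have hsp : 0 < √((2 * k : ℕ) : ℝ) := sqrt_pos.2 hk0
  have hB := choose_two_mul_self_pos k
  have h1 := choose_sq_le k
  have h2 := le_choose_sq hk
  have hp : ((2 : ℝ) ^ (2 * k)) ^ 2 = 16 ^ k := by
    rw [← pow_mul, mul_comm, ← mul_assoc, pow_mul]; norm_num
  rw [gammaStar_two_mul]
  set B := ((2 * k).choose k : ℝ)
  set R := √((2 * k : ℕ) : ℝ)
  have hP : (0 : ℝ) < 2 ^ (2 * k) := by positivity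
  set P := (2 : ℝ) ^ (2 * k)
  have hR2 : R ^ 2 = 2 * k := by rw [hsq]; push_cast; ring
  have e1 : B * R ≤ P := by
    refine (pow_le_pow_iff_left₀ (by positivity) hP.le two_ne_zero).1 ?_
    rw [mul_pow, hp, hR2]
    nlinarith [sq_nonneg B]
  have e2 : P ≤ 2 * (B * R) := by
    refine (pow_le_pow_iff_left₀ hP.le (by positivity) two_ne_zero).1 ?_
    rw [hp, mul_pow, mul_pow, hR2]
    nlinarith [mul_nonneg (sq_nonneg B) (k.cast_nonneg (α := ℝ))]
  rw [← hsq]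
  constructor
  · rw [one_mul, mul_one_div, div_le_div_iff₀ hP hB]
    nlinarith
  · rw [mul_one_div, ← mul_div_assoc, div_le_div_iff₀ hB hP]
    nlinarith

/-! ### The averaged difference as C(2k,k)(1 - U), and the multiplier of U. -/

lemma sum_Icc_one_eq (k : ℕ) (F : ℕ → ℝ) :
    ∑ i ∈ Finset.Icc 1 k, F i = ∑ i ∈ Finset.range k, F (i + 1) := by
  induction k with
  | zero => simp
  | succ k ih => rw [Finset.sum_Icc_succ_top (by omega), ih, Finset.sum_range_succ]

lemma sum_Icc_neg_eq (k : ℕ) (F : ℤ → ℝ) :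
    ∑ i ∈ Finset.Icc (-(k : ℤ)) k, F i = F 0 + ∑ i ∈ Finset.Icc 1 k, (F i + F (-i)) := by
  induction k with
  | zero => simp
  | succ k ih =>
    have : Finset.Icc (-((k + 1 : ℕ) : ℤ)) ((k + 1 : ℕ) : ℤ)
        = insert (((k + 1 : ℕ) : ℤ)) (insert (-((k + 1 : ℕ) : ℤ)) (Finset.Icc (-(k : ℤ)) k)) := by
      ext i
      simp only [Finset.mem_Icc, Finset.mem_insert]
      omega
    rw [this, Finset.sum_insert (by simp only [Finset.mem_insert, Finset.mem_Icc]; omega),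
      Finset.sum_insert (by simp only [Finset.mem_Icc]; omega), ih,
      Finset.sum_Icc_succ_top (by omega)]
    ring

lemma centralDiff_eq (k : ℕ) (t : ℝ) (f : ℝ → ℝ) (x : ℝ) :
    centralDiff k t f x = (2 * k).choose k * (f x - ∑ i ∈ Finset.Icc 1 k,
      (-1) ^ (i + 1) * binomRatio k i * (f (x + i * t) + f (x - i * t))) := by
  unfold centralDiff
  rw [sum_Icc_neg_eq, mul_sub, Finset.mul_sum, sub_eq_add_neg, ← Finset.sum_neg_distrib]
  congr 1
  · simp
  · refine Finset.sum_congr rfl fun i hi => ?_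
    have hik := (Finset.mem_Icc.1 hi).2
    have h1 : ((k : ℤ) + i).toNat = k + i := by omega
    have h2 : ((k : ℤ) + -i).toNat = k - i := by omega
    have h3 : (2 * k).choose (k - i) = (2 * k).choose (k + i) :=
      Nat.choose_symm_of_eq_add (by omega)
    have h4 : ((2 * k).choose k : ℝ) ≠ 0 := (choose_two_mul_self_pos k).ne'
    have h5 : ((-1 : ℝ)) ^ (-(i : ℤ)) = (-1) ^ i := by
      rw [zpow_neg, zpow_natCast]
      rcases neg_one_pow_eq_or ℝ i with h | h <;> rw [h] <;> norm_num
    rw [h1, h2, h3, h5, zpow_natCast]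
    unfold binomRatio
    push_cast
    rw [neg_mul, ← sub_eq_add_neg, pow_succ]
    field_simp

/-- The descending branch of the hat function, doubled. -/
noncomputable def hatBranch (h t : ℝ) : ℝ := 2 / h * (1 - t / h)

lemma continuous_hatBranch (h : ℝ) : Continuous (hatBranch h) := by
  unfold hatBranch
  fun_prop

/-- The averaging operator `U` with `∫ Δ_t f φ_h(t) dt = C(2k, k) (f - U f)`. -/
noncomputable def avgOp (k : ℕ) (h : ℝ) (f : ℝ → ℝ) (x : ℝ) : ℝ :=
  ∑ i ∈ Finset.Icc 1 k, (-1) ^ (i + 1) * binomRatio k i *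
    ∫ t in (0 : ℝ)..h, hatBranch h t * (f (x + i * t) + f (x - i * t))

lemma hat_eq_max {h : ℝ} (hh : 0 < h) (t : ℝ) : hat h t = max 0 (1 / h * (1 - |t| / h)) := by
  unfold hat
  split_ifs with ht
  · rw [max_eq_right]
    have : |t| / h ≤ 1 := (div_le_one hh).2 ht
    exact mul_nonneg (by positivity) (by linarith)
  · rw [max_eq_left]
    have : 1 ≤ |t| / h := (one_le_div hh).2 (le_of_not_ge ht)
    exact mul_nonpos_of_nonneg_of_nonpos (by positivity) (by linarith)

lemma integral_mul_hat {g : ℝ → ℝ} (hg : Continuous g) (heven : ∀ t, g (-t) = g t) {h : ℝ}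
    (hh : 0 < h) : ∫ t, g t * hat h t = ∫ t in (0 : ℝ)..h, hatBranch h t * g t := by
  have hc : Continuous fun t => g t * hat h t := by
    simp only [hat_eq_max hh]
    fun_prop
  have e1 : ∫ t, g t * hat h t = ∫ t in (-h)..h, g t * hat h t := by
    rw [intervalIntegral.integral_of_le (by linarith)]
    refine (MeasureTheory.setIntegral_eq_integral_of_forall_compl_eq_zero fun t ht => ?_).symm
    have : h ≤ |t| := by
      by_contra! hlt
      exact ht ⟨(abs_lt.1 hlt).1, (abs_lt.1 hlt).2.le⟩
    rw [hat_eq_max hh, max_eq_left, mul_zero]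
    have : 1 ≤ |t| / h := (one_le_div hh).2 this
    exact mul_nonpos_of_nonneg_of_nonpos (by positivity) (by linarith)
  rw [e1, integral_neg_self_of_even hc (fun t => by
    rw [heven]; unfold hat; rw [abs_neg]), ← intervalIntegral.integral_const_mul]
  refine intervalIntegral.integral_congr fun t ht => ?_
  rw [Set.uIcc_of_le hh.le] at ht
  simp only [hat, hatBranch, abs_of_nonneg ht.1, if_pos ht.2]
  ring

lemma integral_hatBranch {h : ℝ} (hh : 0 < h) : ∫ t in (0 : ℝ)..h, hatBranch h t = 1 := by
  unfold hatBranch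
  rw [intervalIntegral.integral_const_mul, intervalIntegral.integral_sub
    (by simp) ((by fun_prop : Continuous _).intervalIntegrable _ _),
    intervalIntegral.integral_div, integral_id]
  simp
  field_simp
  ring

lemma integral_centralDiff_mul_hat (k : ℕ) {f : ℝ → ℝ} (hf : Continuous f) {h : ℝ} (hh : 0 < h)
    (x : ℝ) : ∫ t, centralDiff k t f x * hat h t
      = (2 * k).choose k * (f x - avgOp k h f x) := by
  have hb := continuous_hatBranch h
  have hterm : ∀ i : ℕ, Continuous fun t =>
      hatBranch h t * (f (x + i * t) + f (x - i * t)) := fun i => by fun_prop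
  rw [integral_mul_hat (g := fun t => centralDiff k t f x) (by
      simp only [centralDiff_eq]
      fun_prop) (fun t => by
      simp only [centralDiff_eq, mul_neg, sub_neg_eq_add, ← sub_eq_add_neg]
      simp only [add_comm]) hh]
  have e : ∀ t, hatBranch h t * centralDiff k t f x = (2 * k).choose k * (hatBranch h t * f x
      - ∑ i ∈ Finset.Icc 1 k, (-1) ^ (i + 1) * binomRatio k i *
        (hatBranch h t * (f (x + i * t) + f (x - i * t)))) := by
    intro t
    rw [centralDiff_eq, mul_left_comm, mul_sub (hatBranch h t), Finset.mul_sum]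
    congr 2
    exact Finset.sum_congr rfl fun i _ => by ring
  simp only [e]
  rw [intervalIntegral.integral_const_mul, intervalIntegral.integral_sub
    ((by fun_prop : Continuous _).intervalIntegrable _ _)
    ((by fun_prop : Continuous _).intervalIntegrable _ _), intervalIntegral.integral_mul_const,
    integral_hatBranch hh, intervalIntegral.integral_finsetSum (fun i _ =>
      ((by fun_prop : Continuous _).intervalIntegrable _ _))]
  simp only [intervalIntegral.integral_const_mul, one_mul, avgOp]

lemma integral_hatBranch_mul_cos {h ω : ℝ} (hh : 0 < h) (hω : ω ≠ 0) :
    ∫ t in (0 : ℝ)..h, hatBranch h t * (2 * cos (ω * t))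
      = 2 * (2 - 2 * cos (ω * h)) / (ω * h) ^ 2 := by
  have hb := continuous_hatBranch h
  have hd : ∀ t ∈ Set.uIcc 0 h, HasDerivAt
      (fun t => 4 / h * ((1 - t / h) * (sin (ω * t) / ω) - cos (ω * t) / (ω ^ 2 * h)))
      (hatBranch h t * (2 * cos (ω * t))) t := by
    intro t _
    have hl : HasDerivAt (fun t => ω * t) ω t := by simpa using (hasDerivAt_id t).const_mul ω
    have h1 : HasDerivAt (fun t => 1 - t / h) (-(1 / h)) t := by
      simpa using ((hasDerivAt_id t).div_const h).const_sub 1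
    have := ((h1.mul (hl.sin.div_const ω)).sub (hl.cos.div_const (ω ^ 2 * h))).const_mul (4 / h)
    refine this.congr_deriv ?_
    unfold hatBranch
    field_simp
    ring
  rw [intervalIntegral.integral_eq_sub_of_hasDerivAt hd
    ((by fun_prop : Continuous _).intervalIntegrable _ _)]
  simp
  field_simp
  ring

/-- The multiplier of `avgOp`. -/
noncomputable def avgMult (k : ℕ) (h : ℝ) (ν : ℕ) : ℝ :=
  ∑ i ∈ Finset.Icc 1 k, (-1) ^ (i + 1) * binomRatio k i *
    ∫ t in (0 : ℝ)..h, hatBranch h t * (2 * cos (ν * (i * t)))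

lemma hasMultiplier_avgOp (k : ℕ) (h : ℝ) : HasMultiplier (avgOp k h) (avgMult k h) :=
  HasMultiplier.sum _ fun i _ =>
    (HasMultiplier.integral_shift (continuous_hatBranch h) h i).const_mul _

lemma avgMult_eq (k : ℕ) {h : ℝ} (hh : 0 < h) {ν : ℕ} (hν : 1 ≤ ν) :
    avgMult k h ν = ∑ i ∈ Finset.Icc 1 k, (-1) ^ (i + 1) * binomRatio k i *
      (2 * (2 - 2 * cos (ν * (i * h))) / (ν * (i * h)) ^ 2) := by
  refine Finset.sum_congr rfl fun i hi => ?_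
  have hi1 := (Finset.mem_Icc.1 hi).1
  have := integral_hatBranch_mul_cos hh (ω := ν * i) (by positivity)
  simp only [mul_assoc] at this ⊢
  rw [this]

/-- At ν = n the phase of the i-th term is iπ, so 2 - 2cos is 4 for odd i and 0 for even i; hence
the sum over odd i in μ². -/
lemma avgMult_self (k : ℕ) {n : ℕ} (hn : 1 ≤ n) : avgMult k (π / n) n = muSq k := by
  have hn' : (0 : ℝ) < n := by exact_mod_cast hn
  rw [avgMult_eq k (by positivity) hn, muSq, Finset.mul_sum, Finset.sum_filter]
  refine Finset.sum_congr rfl fun i hi => ?_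
  have hi1 := (Finset.mem_Icc.1 hi).1
  rw [show (n : ℝ) * (i * (π / n)) = i * π by field_simp, cos_nat_mul_pi]
  split_ifs with ho
  · rw [ho.neg_one_pow, (ho.add_one).neg_one_pow]
    field_simp
    ring
  · rw [(Nat.not_odd_iff_even.1 ho).neg_one_pow]
    simp

lemma avgOp_cos (k : ℕ) {n : ℕ} (hn : 1 ≤ n) (x : ℝ) :
    avgOp k (π / n) (fun x => cos (n * x)) x = muSq k * cos (n * x) := by
  rw [← avgMult_self k hn, avgMult, avgOp, Finset.sum_mul]
  refine Finset.sum_congr rfl fun i _ => ?_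
  rw [mul_assoc (_ * _), ← intervalIntegral.integral_mul_const]
  congr 2; ext t
  have hcos : IsHarmonic n fun x => cos (n * x) := Or.inl rfl
  have := hcos.add_add_sub x (i * t)
  rw [add_comm, this]
  ring

/-! ### Bounds for the iterates of U and the Neumann series. -/

/-- The difference operator with `avgOp k h = diffOp k h ∘ D⁻²`. -/
noncomputable def diffOp (k : ℕ) (h : ℝ) (f : ℝ → ℝ) (x : ℝ) : ℝ :=
  ∑ i ∈ Finset.Icc 1 k, ((-1) ^ (i + 1) * binomRatio k i * 2 / (i * h) ^ 2) *
    (2 * f x - (f (x + i * h) + f (x - i * h)))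

lemma hasMultiplier_diffOp (k : ℕ) (h : ℝ) :
    HasMultiplier (diffOp k h) (fun ν => ∑ i ∈ Finset.Icc 1 k,
      ((-1) ^ (i + 1) * binomRatio k i * 2 / (i * h) ^ 2) *
        (2 * 1 - 2 * cos (ν * (i * h)))) :=
  HasMultiplier.sum _ fun i _ =>
    ((HasMultiplier.id.const_mul 2).sub (HasMultiplier.shift (i * h))).const_mul _

/-- The central coefficient 2Σc_i is nonnegative because the c_i alternate and decrease in size. The
total mass is then 2Σ(c_i + |c_i|), in which even i cancel and odd i add up to n²μ². -/
lemma abs_diffOp_le (k : ℕ) {n : ℕ} (hn : 1 ≤ n) {f : ℝ → ℝ} {B : ℝ} (hf : ∀ x, |f x| ≤ B) (x : ℝ) :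
    |diffOp k (π / n) f x| ≤ n ^ 2 * muSq k * B := by
  have hn' : (0 : ℝ) < n := by exact_mod_cast hn
  have hB : 0 ≤ B := (abs_nonneg _).trans (hf 0)
  set c : ℕ → ℝ := fun i => (-1) ^ (i + 1) * binomRatio k i * 2 / (i * (π / n)) ^ 2 with hc
  have hsum : 0 ≤ ∑ i ∈ Finset.Icc 1 k, c i := by
    rw [sum_Icc_one_eq]
    have h := alternating_sum_nonneg
      (b := fun i => binomRatio k (i + 1) * 2 / (((i + 1 : ℕ) : ℝ) * (π / n)) ^ 2)
      (fun i j hij => by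
        have h1 := antitone_binomRatio k (Nat.add_le_add_right hij 1)
        have h2 := binomRatio_nonneg k (i + 1)
        have h3 : ((i + 1 : ℕ) : ℝ) ≤ (j + 1 : ℕ) := by exact_mod_cast Nat.add_le_add_right hij 1
        dsimp only
        gcongr)
      (fun i => by have := binomRatio_nonneg k (i + 1); positivity) k
    refine h.trans_eq (Finset.sum_congr rfl fun i _ => ?_)
    simp only [hc, pow_succ]
    ring
  have htot : ∑ i ∈ Finset.Icc 1 k, (c i + |c i|) * (2 * B) = n ^ 2 * muSq k * B := by
    rw [muSq, Finset.mul_sum, Finset.mul_sum, Finset.sum_mul, Finset.sum_filter]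
    refine Finset.sum_congr rfl fun i hi => ?_
    have hi1 := (Finset.mem_Icc.1 hi).1
    have h0 := binomRatio_nonneg k i
    have hcp : 0 ≤ binomRatio k i * 2 / (i * (π / n)) ^ 2 := by positivity
    split_ifs with ho
    · have : c i = binomRatio k i * 2 / (i * (π / n)) ^ 2 := by
        simp only [hc]
        rw [(ho.add_one).neg_one_pow, one_mul]
      rw [this, abs_of_nonneg hcp]
      field_simp
      ring
    · have : c i = -(binomRatio k i * 2 / (i * (π / n)) ^ 2) := by
        simp only [hc]
        rw [((Nat.not_odd_iff_even.1 ho).add_one).neg_one_pow]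
        ring
      rw [this, abs_neg, abs_of_nonneg hcp]
      simp
  have hsplit : diffOp k (π / n) f x = (∑ i ∈ Finset.Icc 1 k, c i) * (2 * f x)
      - ∑ i ∈ Finset.Icc 1 k, c i * (f (x + i * (π / n)) + f (x - i * (π / n))) := by
    rw [Finset.sum_mul, ← Finset.sum_sub_distrib]
    exact Finset.sum_congr rfl fun i _ => by simp only [hc]; ring
  rw [hsplit, ← htot]
  simp only [add_mul]
  rw [Finset.sum_add_distrib, ← Finset.sum_mul]
  refine (abs_sub _ _).trans (add_le_add ?_ ((Finset.abs_sum_le_sum_abs _ _).trans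
    (Finset.sum_le_sum fun i _ => ?_)))
  · rw [abs_mul, abs_of_nonneg hsum, abs_mul, abs_two]
    gcongr
    exact hf x
  · rw [abs_mul]
    gcongr
    refine (abs_add_le _ _).trans ?_
    linarith [hf (x + i * (π / n)), hf (x - i * (π / n))]

lemma abs_iterate_diffOp_le (k : ℕ) {n : ℕ} (hn : 1 ≤ n) {f : ℝ → ℝ} {B : ℝ}
    (hf : ∀ x, |f x| ≤ B) (m : ℕ) (x : ℝ) :
    |(diffOp k (π / n))^[m] f x| ≤ (n ^ 2 * muSq k) ^ m * B := by
  induction m generalizing x with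
  | zero => simpa using hf x
  | succ m ih =>
    rw [Function.iterate_succ_apply', pow_succ', mul_assoc]
    exact abs_diffOp_le k hn ih x

/-- Iterates of `avgOp` are bounded on functions of high frequency. -/
lemma abs_iterate_avgOp_le (k : ℕ) {n : ℕ} (hn : 1 ≤ n) {f : ℝ → ℝ} (hf : IsHighFreq n f) {B : ℝ}
    (hB : ∀ x, |f x| ≤ B) (m : ℕ) (x : ℝ) :
    |(avgOp k (π / n))^[m] f x| ≤ 4 / π * muSq k ^ m * B := by
  have hn' : (0 : ℝ) < n := by exact_mod_cast hn
  have hB0 : 0 ≤ B := (abs_nonneg _).trans (hB 0)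
  -- The kernel is available only for m ≥ 1; for m = 0 the bound is just π ≤ 4.
  rcases Nat.eq_zero_or_pos m with rfl | hm
  · have : 1 ≤ 4 / π := (one_le_div pi_pos).2 pi_le_four
    simp only [Function.iterate_zero, id, pow_zero, mul_one]
    exact (hB x).trans (le_mul_of_one_le_left hB0 this)
  obtain ⟨κ, hκ, hmult, hnorm⟩ := exists_kernel hn hm
  have hK := HasMultiplier.integral_shift hκ π 1
  have hG := (hasMultiplier_diffOp k (π / n)).iterate m
  have heq := ((hasMultiplier_avgOp k (π / n)).iterate m).apply_eq (hG.comp hK) (fun ν hν => by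
    have hν1 : 1 ≤ ν := hn.trans hν
    have hν' : (0 : ℝ) < ν := by exact_mod_cast hν1
    rw [hmult ν hν, avgMult_eq k (by positivity) hν1, pow_mul, ← inv_pow, ← mul_pow,
      Finset.sum_mul]
    congr 1
    refine Finset.sum_congr rfl fun i hi => ?_
    have hi1 := (Finset.mem_Icc.1 hi).1
    field_simp) hf
  rw [heq]
  have hKb : ∀ x, |∫ t in (0 : ℝ)..π, κ t * (f (x + 1 * t) + f (x - 1 * t))|
      ≤ 4 / π * ((n : ℝ) ^ (2 * m))⁻¹ * B := by
    intro x
    refine le_trans ?_ (mul_le_mul_of_nonneg_right hnorm hB0)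
    rw [← intervalIntegral.integral_mul_const, ← Real.norm_eq_abs]
    refine intervalIntegral.norm_integral_le_of_norm_le pi_pos.le (.of_forall fun t _ => ?_)
      ((by fun_prop : Continuous _).intervalIntegrable _ _)
    rw [norm_mul, Real.norm_eq_abs, Real.norm_eq_abs, mul_assoc]
    gcongr
    refine (abs_add_le _ _).trans ?_
    linarith [hB (x + 1 * t), hB (x - 1 * t)]
  refine (abs_iterate_diffOp_le k hn hKb m x).trans_eq ?_
  rw [mul_pow, ← pow_mul]
  field_simp

/-- The Jackson–Stechkin estimate for the averaged difference. -/
lemma abs_le_of_abs_sub_avgOp_le {k n : ℕ} (hk : 1 ≤ k) (hn : 1 ≤ n) {f : ℝ → ℝ}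
    (hf : IsHighFreq n f) {B : ℝ} (hB : ∀ x, |f x - avgOp k (π / n) f x| ≤ B) (x : ℝ) :
    |f x| ≤ 4 / π / (1 - muSq k) * B := by
  have hB0 : 0 ≤ B := (abs_nonneg _).trans (hB 0)
  have hμ0 := muSq_nonneg k
  have hμ1 := muSq_lt_one hk
  set U := avgOp k (π / n)
  have hU : HasMultiplier U (avgMult k (π / n)) := hasMultiplier_avgOp k (π / n)
  have hW := HasMultiplier.id.sub hU
  obtain ⟨A, hA⟩ := hf.1.exists_bound
  -- Additivity of the iterates of U is read off from multipliers instead of being proved for the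
  -- operator.
  have hstep : ∀ j, U^[j] (fun x => f x - U f x) = fun x => U^[j] f x - U^[j + 1] f x := fun j =>
    ((hU.iterate j).comp hW).apply_eq ((hU.iterate j).sub (hU.iterate (j + 1)))
      (fun ν _ => by ring) hf
  have hbound : ∀ M : ℕ, |f x| ≤ 4 / π / (1 - muSq k) * B + 4 / π * muSq k ^ M * A := by
    intro M
    have htel : f x = ∑ j ∈ Finset.range M, U^[j] (fun x => f x - U f x) x + U^[M] f x := by
      have : ∑ j ∈ Finset.range M, U^[j] (fun x => f x - U f x) x = f x - U^[M] f x := by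
        simp only [hstep, Finset.sum_range_sub' (fun j => U^[j] f x)]
        simp
      rw [this]; ring
    rw [htel]
    refine (abs_add_le _ _).trans (add_le_add ?_ (abs_iterate_avgOp_le k hn hf hA M x))
    calc _ ≤ ∑ j ∈ Finset.range M, 4 / π * muSq k ^ j * B :=
          (Finset.abs_sum_le_sum_abs _ _).trans (Finset.sum_le_sum fun j _ =>
            abs_iterate_avgOp_le k hn (hW.isHighFreq hf) hB j x)
      _ = 4 / π * B * ∑ j ∈ Finset.range M, muSq k ^ j := by
          rw [Finset.mul_sum]
          exact Finset.sum_congr rfl fun j _ => by ring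
      _ ≤ 4 / π * B * (1 - muSq k)⁻¹ := by
          refine mul_le_mul_of_nonneg_left ?_ (by positivity)
          rw [← tsum_geometric_of_lt_one hμ0 hμ1]
          exact (summable_geometric_of_lt_one hμ0 hμ1).sum_le_tsum _ fun j _ => by positivity
      _ = _ := by ring
  have hlim : Tendsto (fun M : ℕ => 4 / π / (1 - muSq k) * B + 4 / π * muSq k ^ M * A) atTop
      (𝓝 (4 / π / (1 - muSq k) * B + 4 / π * 0 * A)) :=
    (((tendsto_pow_atTop_nhds_zero_of_lt_one hμ0 hμ1).const_mul _).mul_const _).const_add _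
  simpa using ge_of_tendsto' hlim hbound

/-! ### The extremal function cos(nx) and the bounds for the supremum. -/

lemma pair_comm (f e : ℝ → ℝ) : pair f e = pair e f := by simp only [pair, mul_comm]

/-- Shifting by π/n flips the sign of cos nx, so 1 + cos(νπ/n) annihilates the pairing; it is
nonzero since νπ/n < π. -/
lemma pair_cos_eq_zero {n ν : ℕ} (h : ν < n) {e : ℝ → ℝ} (he : IsHarmonic ν e) :
    pair (fun x => cos (n * x)) e = 0 := by
  have hn' : (0 : ℝ) < n := by exact_mod_cast (by omega : 0 < n)
  have hν' : (ν : ℝ) < n := by exact_mod_cast h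
  have hcos : IsHarmonic n fun x => cos (n * x) := Or.inl rfl
  have h1 := pair_shift hcos.isCircleFun he (π / n)
  have h2 : (fun x : ℝ => cos (n * (x + π / n)) + cos (n * (x - π / n)))
      = fun x => -2 * cos (n * x) := by
    ext x
    have := hcos.add_add_sub x (π / n)
    rw [add_comm, this, show n * (π / n) = π by field_simp, cos_pi]
    ring
  rw [h2, pair_const_mul] at h1
  have h3 : -1 < cos (ν * (π / n)) := by
    rw [← cos_pi]
    refine cos_lt_cos_of_nonneg_of_le_pi (by positivity) le_rfl ?_
    rw [← mul_div_assoc, div_lt_iff₀ hn', mul_comm]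
    exact mul_lt_mul_of_pos_left hν' pi_pos
  have h4 : (1 + cos (ν * (π / n))) * pair (fun x => cos (n * x)) e = 0 := by linarith
  exact (mul_eq_zero.1 h4).resolve_left (by linarith)

lemma cos_mem_trigPerp {n : ℕ} (hn : 1 ≤ n) : (fun x => cos (n * x)) ∈ trigPerp (n - 1) := by
  have hcos : IsCircleFun fun x => cos (n * x) := IsHarmonic.isCircleFun (ν := n) (Or.inl rfl)
  refine ⟨hcos.1, hcos.2, fun τ hτ => ?_⟩
  suffices IsCircleFun τ ∧ pair τ (fun x => cos (n * x)) = 0 by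
    have h := this.2
    rwa [pair_comm] at h
  induction hτ using Submodule.span_induction with
  | mem e he =>
    obtain ⟨j, hj, he⟩ := he
    exact ⟨IsHarmonic.isCircleFun he, by rw [pair_comm]; exact pair_cos_eq_zero (by omega) he⟩
  | zero => exact ⟨⟨continuous_zero, fun _ => rfl⟩, by simp [pair]⟩
  | add e e' _ _ h h' =>
    exact ⟨h.1.add h'.1, (pair_add h.1 h'.1 hcos).trans (by rw [h.2, h'.2, add_zero])⟩
  | smul c e _ h =>
    exact ⟨h.1.const_mul c, (pair_const_mul e _ c).trans (by rw [h.2, mul_zero])⟩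

lemma omegaStar_eq {k n : ℕ} (hn : 1 ≤ n) {f : ℝ → ℝ} (hf : Continuous f) :
    omegaStar k f (π / n)
      = uniformNorm fun x => (2 * k).choose k * (f x - avgOp k (π / n) f x) := by
  have hn' : (0 : ℝ) < n := by exact_mod_cast hn
  unfold omegaStar
  simp only [integral_centralDiff_mul_hat k hf (by positivity : 0 < π / n)]

lemma uniformNorm_le {f : ℝ → ℝ} {B : ℝ} (h : ∀ x, |f x| ≤ B) :
    uniformNorm f ≤ ENNReal.ofReal B :=
  iSup_le fun x => by
    rw [Real.enorm_eq_ofReal_abs]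
    exact ENNReal.ofReal_le_ofReal (h x)

lemma abs_le_toReal_uniformNorm {f : ℝ → ℝ} (h : uniformNorm f ≠ ⊤) (x : ℝ) :
    |f x| ≤ (uniformNorm f).toReal := by
  rw [← ENNReal.ofReal_le_iff_le_toReal h, ← Real.enorm_eq_ofReal_abs]
  exact le_iSup (fun x => ‖f x‖ₑ) x

lemma le_supRatio {k n : ℕ} (hk : 1 ≤ k) (hn : 1 ≤ n) :
    ENNReal.ofReal (gammaStar (2 * k) / (1 - muSq k)) ≤ supRatio k n := by
  have hμ : 0 < 1 - muSq k := sub_pos.2 (muSq_lt_one hk)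
  have hC := choose_two_mul_self_pos k
  refine le_trans ?_ (le_iSup₂ (f := fun f _ => uniformNorm f / omegaStar k f (π / n))
    _ (cos_mem_trigPerp hn))
  have h1 : (1 : ℝ≥0∞) ≤ uniformNorm fun x => cos (n * x) := by
    refine le_trans ?_ (le_iSup (fun x : ℝ => ‖cos (n * x)‖ₑ) 0)
    simp
  have h2 : omegaStar k (fun x => cos (n * x)) (π / n)
      ≤ ENNReal.ofReal ((2 * k).choose k * (1 - muSq k)) := by
    rw [omegaStar_eq hn (by fun_prop)]
    refine uniformNorm_le fun x => ?_
    rw [avgOp_cos k hn, abs_mul, abs_of_pos hC, ← one_sub_mul, abs_mul, abs_of_pos hμ]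
    exact mul_le_mul_of_nonneg_left (mul_le_of_le_one_right hμ.le (abs_cos_le_one _)) hC.le
  calc ENNReal.ofReal (gammaStar (2 * k) / (1 - muSq k))
      = 1 / ENNReal.ofReal ((2 * k).choose k * (1 - muSq k)) := by
        rw [gammaStar_two_mul, div_div, ENNReal.ofReal_div_of_pos (by positivity),
          ENNReal.ofReal_one]
    _ ≤ _ := ENNReal.div_le_div h1 h2

lemma supRatio_le {k n : ℕ} (hk : 1 ≤ k) (hn : 1 ≤ n) :
    supRatio k n ≤ ENNReal.ofReal (4 / π * (gammaStar (2 * k) / (1 - muSq k))) := by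
  have hμ : 0 < 1 - muSq k := sub_pos.2 (muSq_lt_one hk)
  have hC := choose_two_mul_self_pos k
  -- The product form also settles a vanishing modulus: it forces ‖f‖ = 0. The finite bound thus
  -- contains the positivity of ω* for nonzero f.
  refine iSup₂_le fun f hf => ENNReal.div_le_of_le_mul ?_
  have hhf := isHighFreq_of_mem_trigPerp hn hf
  rw [omegaStar_eq hn hf.1]
  set W : ℝ → ℝ := fun x => (2 * k).choose k * (f x - avgOp k (π / n) f x)
  have hWc : IsCircleFun W :=
    (hhf.1.sub ((hasMultiplier_avgOp k (π / n)).isCircleFun f hhf.1)).const_mul _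
  obtain ⟨A, hA⟩ := hWc.exists_bound
  have htop : uniformNorm W ≠ ⊤ := ((uniformNorm_le hA).trans_lt ENNReal.ofReal_lt_top).ne
  have hB : ∀ x, |f x - avgOp k (π / n) f x| ≤ gammaStar (2 * k) * (uniformNorm W).toReal := by
    intro x
    have h : |(2 * k).choose k * (f x - avgOp k (π / n) f x)| ≤ (uniformNorm W).toReal :=
      abs_le_toReal_uniformNorm htop x
    rw [abs_mul, abs_of_pos hC] at h
    rw [gammaStar_two_mul, one_div, ← div_eq_inv_mul, le_div_iff₀' hC]
    exact h
  rw [← ENNReal.ofReal_toReal htop, ← ENNReal.ofReal_mul (by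
    have := gammaStar_pos k
    positivity)]
  refine uniformNorm_le fun x => (abs_le_of_abs_sub_avgOp_le hk hn hhf hB x).trans_eq ?_
  ring

end JacksonStechkin

theorem mainTheorem7 :
    (∀ k n : ℕ, 1 ≤ k → 1 ≤ n →
      JacksonStechkin.muSq k < 1 ∧
      ENNReal.ofReal (JacksonStechkin.gammaStar (2 * k) / (1 - JacksonStechkin.muSq k))
        ≤ JacksonStechkin.supRatio k n ∧
      JacksonStechkin.supRatio k n
        ≤ ENNReal.ofReal (4 / Real.pi *
            (JacksonStechkin.gammaStar (2 * k) / (1 - JacksonStechkin.muSq k)))) ∧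
    (∃ c C : ℝ, 0 < c ∧ 0 < C ∧ ∀ k : ℕ, 1 ≤ k →
      c * (Real.sqrt ((2 * k : ℕ) : ℝ) * JacksonStechkin.gammaStar (2 * k))
        ≤ JacksonStechkin.gammaStar (2 * k) / (1 - JacksonStechkin.muSq k) ∧
      JacksonStechkin.gammaStar (2 * k) / (1 - JacksonStechkin.muSq k)
        ≤ C * (Real.sqrt ((2 * k : ℕ) : ℝ) * JacksonStechkin.gammaStar (2 * k))) ∧
    (∃ c C : ℝ, 0 < c ∧ 0 < C ∧ ∀ k : ℕ, 1 ≤ k →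
      c * (((2 * k : ℕ) : ℝ) / 2 ^ (2 * k))
        ≤ Real.sqrt ((2 * k : ℕ) : ℝ) * JacksonStechkin.gammaStar (2 * k) ∧
      Real.sqrt ((2 * k : ℕ) : ℝ) * JacksonStechkin.gammaStar (2 * k)
        ≤ C * (((2 * k : ℕ) : ℝ) / 2 ^ (2 * k))) :=
  ⟨fun _ _ hk hn => ⟨JacksonStechkin.muSq_lt_one hk, JacksonStechkin.le_supRatio hk hn,
    JacksonStechkin.supRatio_le hk hn⟩,
    JacksonStechkin.gammaStar_div_asymp, JacksonStechkin.sqrt_mul_gammaStar_asymp⟩
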